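/- Let $D\subseteq[0,\infty)$ be a non-degenerate interval with $0\in D$, i.e. $D=[0,T)$ with $0<T\le\infty$ or $D=[0,T]$ with $0<T<\infty$, and let $\psi:D\to[0,\infty)$ be a probability density that is positive a.e. on $D$. Put $\overline\psi(t)=\int_{D\cap(t,\infty)}\psi(y)\,dy$. Let $1\le p,q\le\infty$, $1/p+1/p'=1$, and assume that either $p=\infty$ and $\overline\psi\in L_1(D)$, or $p<\infty$, $\psi^{-1/p}\in L_{p'}([0,x))$ for every $x\in D$, and $\overline\psi\,\psi^{-1/p}\in L_{p'}(D)$. For $u\subseteq\{1,\dots,d\}$ let $L_{p,\psi}(D^u)$ be the $L_p$ space on $D^u$ with respect to $\prod_{j\in u}\psi(t_j)\,dt$ (for $u=\emptyset$ it is $\mathbb R$ with the absolute value). Put $K_{\pitchfork}(x,t)=1_{[0,x)}(t)$, $K_A(x,t)=1_{[0,x)}(t)-\overline\psi(t)$ and, for $*\in\{\pitchfork,A\}$ and $g\in L_{p,\psi}(D^u)$, $$(T_{*,u}g)(x)=\int_{D^u}g(t)\prod_{j\in u}K_*(x_j,t_j)\,dt,\qquad x\in D^d$$ (with $T_{*,\emptyset}c$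 the constant function $c$). For non-negative weights $\gamma=(\gamma_u)_{u\subseteq\{1,\dots,d\}}$ the anchored space $W_{\pitchfork,p,q,\psi,\gamma}$ and the ANOVA space $W_{A,p,q,\psi,\gamma}$ consist of the functions $f=\sum_{u:\gamma_u>0}T_{*,u}(g_u)$ on $D^d$ with $g_u\in L_{p,\psi}(D^u)$ (the $g_u$ are uniquely determined by $f$ up to null sets), with norm $$\|f\|_{W_{*,p,q,\psi,\gamma}}=\Bigl(\sum_{u:\gamma_u>0}\bigl(\|g_u\|_{L_{p,\psi}(D^u)}/\gamma_u\bigr)^q\Bigr)^{1/q}$$ (a maximum if $q=\infty$). Fix an integer $r\ge1$ and a real number $\omega>0$, and for every integer $d\ge1$ let $\gamma^{[d]}$ be the finite order weights $\gamma_{d,u}=\omega^{|u|}$ if $|u|\le r$ and $\gamma_{d,u}=0$ if $|u|>r$, $u\subseteq\{1,\dots,d\}$. Then for every $d\ge1$ the spaces $W_{A,p,q,\psi,\gamma^{[d]}}$ and $W_{\pitchfork,p,q,\psi,\gamma^{[d]}}$ are equal as sets of functions, and the embedding $\imath_{p,q,\psi,\gamma^{[d]}}:W_{A,p,q,\psi,\gamma^{[d]}}\hookrightarrow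 W_{\pitchfork,p,q,\psi,\gamma^{[d]}}$ and its inverse are bounded with the same operator norm. As $d\to\infty$, $$\|\imath_{p,q,\psi,\gamma^{[d]}}\|=\Theta\bigl(d^{\,r(1-1/q)}\bigr),$$ where $1/\infty=0$ and the implied constants do not depend on $d$. In particular the anchored and ANOVA norms are polynomially equivalent, i.e. $\|\imath_{p,q,\psi,\gamma^{[d]}}\|=O(d^\tau)$ for some $\tau>0$, and the exponent of polynomial equivalence, i.e. the infimum of all such $\tau>0$, is $r(1-1/q)$. If $q=1$, the norms are uniformly equivalent, i.e. $\sup_{d\ge1}\|\imath_{p,q,\psi,\gamma^{[d]}}\|<\infty$. -/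

import Mathlib

open MeasureTheory Filter
open scoped ENNReal NNReal

namespace AnchoredAnova

/-- `D ⊆ [0,∞)` is a non-degenerate interval with `0 ∈ D`, i.e. `D = [0,T)` with `0 < T ≤ ∞`
or `D = [0,T]` with `0 < T < ∞`. -/
structure IsBaseInterval (D : Set ℝ) : Prop where
  ordConnected : D.OrdConnected
  isLeast_zero : IsLeast D 0
  nontrivial : D.Nontrivial

/-- `ψ` is a probability density on `D` that is positive almost everywhere on `D`
(its values off `D` are never used). -/
structure IsDensity (D : Set ℝ) (ψ : ℝ → ℝ) : Prop where
  aemeasurable : AEMeasurable ψ (volume.restrict D)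
  nonneg : ∀ t ∈ D, 0 ≤ ψ t
  pos_ae : ∀ᵐ t ∂(volume.restrict D), 0 < ψ t
  lintegral_eq_one : ∫⁻ t in D, ENNReal.ofReal (ψ t) = 1

/-- The tail `ψ̄(t) = ∫_{D ∩ (t,∞)} ψ(y) dy`. -/
noncomputable def tail (D : Set ℝ) (ψ : ℝ → ℝ) (t : ℝ) : ℝ :=
  ∫ y in D ∩ Set.Ioi t, ψ y

/-- The integrability condition under which the ANOVA (and hence also the anchored) spaces
are well defined, with `p'` the exponent conjugate to `p`:
either `p = ∞` and `ψ̄ ∈ L₁(D)`, or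
`p < ∞`, `ψ^{-1/p} ∈ L_{p'}^{loc}(D)` and `ψ̄ ψ^{-1/p} ∈ L_{p'}(D)`. -/
def KernelCondition (D : Set ℝ) (ψ : ℝ → ℝ) (p : ℝ≥0∞) : Prop :=
  (p = ∞ ∧ IntegrableOn (tail D ψ) D) ∨
  (p < ∞ ∧
    (∀ x ∈ D, MemLp (fun t => ψ t ^ (-(p⁻¹.toReal))) p.conjExponent
      (volume.restrict (Set.Ico 0 x))) ∧
    MemLp (fun t => tail D ψ t * ψ t ^ (-(p⁻¹.toReal))) p.conjExponent
      (volume.restrict D))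

/-- The two types of decomposition. -/
inductive Kind
  | anchored
  | anova

/-- The kernels `1_{[0,x)}(t)` (anchored) and `1_{[0,x)}(t) - ψ̄(t)` (ANOVA). -/
noncomputable def kernel (D : Set ℝ) (ψ : ℝ → ℝ) : Kind → ℝ → ℝ → ℝ
  | .anchored, x, t => (Set.Ico 0 x).indicator (fun _ => 1) t
  | .anova, x, t => (Set.Ico 0 x).indicator (fun _ => 1) t - tail D ψ t

/-- The cube `D^u`, as a subset of `ℝ^u`. -/
def cube (D : Set ℝ) {d : ℕ} (u : Finset (Fin d)) : Set (u → ℝ) :=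
  Set.univ.pi fun _ => D

/-- The measure `∏_{j ∈ u} ψ(t_j) dt` on `D^u`, so that `L_{p,ψ}(D^u)` consists of the `g` with
`MemLp g p (weightedMeasure D ψ u)`, and `eLpNorm g p (weightedMeasure D ψ u)` is its norm.
For `p = ∞` this is the usual essential supremum on `D^u`, since `ψ > 0` almost everywhere.
For `u = ∅`, `D^u` is a point of mass one. -/
noncomputable def weightedMeasure (D : Set ℝ) (ψ : ℝ → ℝ) {d : ℕ} (u : Finset (Fin d)) :
    Measure (u → ℝ) :=
  (volume.restrict (cube D u)).withDensity fun t => ENNReal.ofReal (∏ j, ψ (t j))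

/-- `(T_u g)(x) = ∫_{D^u} g(t) ∏_{j ∈ u} K(x_j, t_j) dt`, as a function on `D^d`. -/
noncomputable def smoothing (D : Set ℝ) (ψ : ℝ → ℝ) (k : Kind) {d : ℕ} (u : Finset (Fin d))
    (g : (u → ℝ) → ℝ) (x : Fin d → D) : ℝ :=
  ∫ t in cube D u, g t * ∏ j : u, kernel D ψ k (x j) (t j)

/-- `f = ∑_u T_u(g_u)` on `D^d` with `g_u ∈ L_{p,ψ}(D^u)`, and `g_u = 0` whenever `γ_u = 0`. -/
structure IsDecomposition (D : Set ℝ) (ψ : ℝ → ℝ) (p : ℝ≥0∞) (k : Kind) {d : ℕ}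
    (γ : Finset (Fin d) → ℝ≥0) (f : (Fin d → D) → ℝ)
    (g : (u : Finset (Fin d)) → (u → ℝ) → ℝ) : Prop where
  memLp : ∀ u, MemLp (g u) p (weightedMeasure D ψ u)
  eq_zero : ∀ u, γ u = 0 → g u =ᵐ[weightedMeasure D ψ u] 0
  sum_eq : ∀ x, f x = ∑ u, smoothing D ψ k u (g u) x

/-- The `γ`-weighted anchored, resp. ANOVA, space, as a set of functions on `D^d`. -/
def space (D : Set ℝ) (ψ : ℝ → ℝ) (p : ℝ≥0∞) (k : Kind) {d : ℕ}
    (γ : Finset (Fin d) → ℝ≥0) : Set ((Fin d → D) → ℝ) :=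
  {f | ∃ g, IsDecomposition D ψ p k γ f g}

/-- The `ℓ_q` norm `|(a_u)_u|_q` over the index set `{u | γ_u > 0}`. -/
noncomputable def lqNorm (q : ℝ≥0∞) {d : ℕ} (γ : Finset (Fin d) → ℝ≥0)
    (a : Finset (Fin d) → ℝ≥0∞) : ℝ≥0∞ :=
  if q = ∞ then ⨆ u ∈ {u | 0 < γ u}, a u
  else (∑ u with 0 < γ u, a u ^ q.toReal) ^ (1 / q.toReal)

/-- The norm `|(‖g_u‖_{L_{p,ψ}(D^u)} / γ_u)_u|_q` of `f = ∑_u T_u(g_u)`. The components `g_u` are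
determined by `f` up to null sets, so the infimum is over a single value if `f` belongs to
the space; the norm is `∞` for all other functions. -/
noncomputable def spaceNorm (D : Set ℝ) (ψ : ℝ → ℝ) (p q : ℝ≥0∞) (k : Kind) {d : ℕ}
    (γ : Finset (Fin d) → ℝ≥0) (f : (Fin d → D) → ℝ) : ℝ≥0∞ :=
  ⨅ (g : (u : Finset (Fin d)) → (u → ℝ) → ℝ) (_ : IsDecomposition D ψ p k γ f g),
    lqNorm q γ fun u => eLpNorm (g u) p (weightedMeasure D ψ u) / γ u

/-- The operator norm of the embedding of the space of kind `k` into the space of kind `k'`: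
the supremum of the `k'`-norm over the closed unit ball of the space of kind `k`. -/
noncomputable def embeddingNorm (D : Set ℝ) (ψ : ℝ → ℝ) (p q : ℝ≥0∞) (k k' : Kind) {d : ℕ}
    (γ : Finset (Fin d) → ℝ≥0) : ℝ≥0∞ :=
  ⨆ f ∈ {f ∈ space D ψ p k γ | spaceNorm D ψ p q k γ f ≤ 1}, spaceNorm D ψ p q k' γ f

/-- For every `d`, the norm `‖ı‖` of the embedding of the ANOVA into the anchored space with
weights `γ d`. -/
noncomputable def iotaNorm (D : Set ℝ) (ψ : ℝ → ℝ) (p q : ℝ≥0∞)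
    (γ : (d : ℕ) → Finset (Fin d) → ℝ≥0) (d : ℕ) : ℝ≥0∞ :=
  embeddingNorm D ψ p q .anova .anchored (γ d)

/-- Uniform equivalence of the norms: the embedding norms are bounded over `d ≥ 1`. -/
def UniformlyEquivalent (N : ℕ → ℝ≥0∞) : Prop :=
  (⨆ (d : ℕ) (_ : 1 ≤ d), N d) < ∞

/-- The embedding norms are finite and `O(d^τ)`. -/
def PolynomialBound (N : ℕ → ℝ≥0∞) (τ : ℝ) : Prop :=
  (∀ d, 1 ≤ d → N d < ∞) ∧
    (fun d : ℕ => (N d).toReal) =O[atTop] fun d : ℕ => (d : ℝ) ^ τ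

/-- Polynomial equivalence of the norms. -/
def PolynomiallyEquivalent (N : ℕ → ℝ≥0∞) : Prop :=
  ∃ τ : ℝ, 0 < τ ∧ PolynomialBound N τ

/-- `e` is the exponent of polynomial equivalence: the infimum of the admissible `τ > 0`. -/
def IsPolynomialExponent (N : ℕ → ℝ≥0∞) (e : ℝ) : Prop :=
  IsGLB {τ : ℝ | 0 < τ ∧ PolynomialBound N τ} e

/-- The special finite order weights: `γ_u = ω^{|u|}` if `|u| ≤ r`, and `γ_u = 0` otherwise. -/
noncomputable def finiteOrderWeights (r : ℕ) (ω : ℝ≥0) (d : ℕ) (u : Finset (Fin d)) : ℝ≥0 :=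
  if u.card ≤ r then ω ^ u.card else 0

end AnchoredAnova

/-! The two kernels differ by a function of `t` alone: each equals the other plus or minus `ψ̄(t)`.
Expanding the product over `u` rewrites a smoothed `g_u` as a sum over `v ⊆ u` of smoothed functions
of the other kind, whose components arise by integrating the variables in `u \ v` against `±ψ̄`
(`smoothing_eq_sum_swap`). So passing between the spaces is the transform `g'_v = ∑_{u ⊇ v} (±1)^{|u
\ v|} ∫ g_u ∏ ψ̄`, and since the weights vanish on supersets of their zeros, the spaces coincide.
Components are unique, so norms can be read off any decomposition (`ae_eq`). The map `g_u ↦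
(-1)^{|u|} g_u` is isometric and intertwines the two transforms, so both embeddings have equal norm.

Upper bound: by Hölder each step from `u` to `v` costs `κ^{|u \ v|}`, where `κ` is the `L_{p'}` norm
of `ψ̄/ψ` under the probability measure `ψ dt`. Only `O(d^r)` sets carry positive weight, each with
at most `2^r` subsets, so the power mean inequality gives `O(d^{r(1-1/q)})`
(`lqNorm_le_of_le_mul_sum`).

Lower bound: take equal constants on all sets of size `r`, normalised in the ANOVA space. The
anchored norm dominates `|f(0)|`, and at `0` all `C(d,r)` terms have the same sign and size, with `∫
ψ̄ > 0`; the value is of order `C(d,r)^{1-1/q}` (`le_iotaNorm`). -/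

namespace AnchoredAnova

/-! ### Tensor products of functions on finite product measures. -/

section ProductMeasures

variable {X : Type*} [MeasurableSpace X]

theorem lintegral_fin_prod_eq_prod {n : ℕ} (μ : Fin n → Measure X) [∀ i, SigmaFinite (μ i)]
    {f : Fin n → X → ℝ≥0∞} (hf : ∀ i, AEMeasurable (f i) (μ i)) :
    ∫⁻ x, ∏ i, f i (x i) ∂(Measure.pi μ) = ∏ i, ∫⁻ x, f i x ∂(μ i) := by
  induction n with
  | zero => simp
  | succ n ih =>
    calc ∫⁻ x, ∏ i, f i (x i) ∂(Measure.pi μ)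
        = ∫⁻ x : X × (Fin n → X), f 0 x.1 * ∏ i : Fin n, f i.succ (x.2 i)
            ∂((μ 0).prod (Measure.pi fun i => μ i.succ)) := by
          rw [← ((measurePreserving_piFinSuccAbove μ 0).symm
            ).lintegral_comp_emb (MeasurableEquiv.measurableEmbedding _)]
          simp [Fin.prod_univ_succ, Fin.insertNthEquiv]
      _ = (∫⁻ x, f 0 x ∂(μ 0)) * ∏ i : Fin n, ∫⁻ x, f i.succ x ∂(μ i.succ) := by
          rw [← ih (fun i => μ i.succ) fun i => hf i.succ]
          have hm : AEMeasurable (fun x : Fin n → X => ∏ i : Fin n, f i.succ (x i))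
              (Measure.pi fun i => μ i.succ) := Finset.aemeasurable_fun_prod _ fun i _ =>
            (hf i.succ).comp_quasiMeasurePreserving
              (Measure.quasiMeasurePreserving_eval (μ := fun i : Fin n => μ i.succ) i)
          exact lintegral_prod_mul (hf 0) hm
      _ = ∏ i, ∫⁻ x, f i x ∂(μ i) := by rw [Fin.prod_univ_succ]

theorem lintegral_pi_prod_eq_prod {ι : Type*} [Fintype ι] (μ : ι → Measure X)
    [∀ i, SigmaFinite (μ i)] {f : ι → X → ℝ≥0∞} (hf : ∀ i, AEMeasurable (f i) (μ i)) :
    ∫⁻ x, ∏ i, f i (x i) ∂(Measure.pi μ) = ∏ i, ∫⁻ x, f i x ∂(μ i) := by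
  let e := (Fintype.equivFin ι).symm
  rw [← (measurePreserving_piCongrLeft μ e).lintegral_comp_emb
    (MeasurableEquiv.measurableEmbedding _)]
  simp_rw [← e.prod_comp, MeasurableEquiv.coe_piCongrLeft, Equiv.piCongrLeft_apply_apply]
  exact lintegral_fin_prod_eq_prod (fun i => μ (e i)) fun i => hf (e i)

theorem aestronglyMeasurable_pi_prod {ι : Type*} [Fintype ι] (μ : Measure X) [SigmaFinite μ]
    {b : ι → X → ℝ} (hb : ∀ i, AEStronglyMeasurable (b i) μ) :
    AEStronglyMeasurable (fun s : ι → X => ∏ i, b i (s i)) (Measure.pi fun _ => μ) :=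
  Finset.aestronglyMeasurable_fun_prod _ fun i _ =>
    (hb i).comp_quasiMeasurePreserving
      (Measure.quasiMeasurePreserving_eval (μ := fun _ : ι => μ) i)

theorem real_enorm_prod {ι : Type*} (s : Finset ι) (f : ι → ℝ) :
    ‖∏ i ∈ s, f i‖ₑ = ∏ i ∈ s, ‖f i‖ₑ := by
  simp only [enorm, nnnorm_prod, ENNReal.ofNNReal_finsetProd]

theorem eLpNorm_pi_prod_le {ι : Type*} [Fintype ι] (μ : Measure X) [SigmaFinite μ]
    {b : ι → X → ℝ} {p : ℝ≥0∞} (hp : p ≠ 0) (hb : ∀ i, AEStronglyMeasurable (b i) μ) :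
    eLpNorm (fun s : ι → X => ∏ i, b i (s i)) p (Measure.pi fun _ => μ)
      ≤ ∏ i, eLpNorm (b i) p μ := by
  by_cases hp' : p = ∞
  · subst hp'
    simp only [eLpNorm_exponent_top]
    refine eLpNormEssSup_le_of_ae_enorm_bound ?_
    have h : ∀ i, ∀ᵐ s ∂(Measure.pi fun _ : ι => μ), ‖b i (s i)‖ₑ ≤ eLpNormEssSup (b i) μ :=
      fun i => (Measure.quasiMeasurePreserving_eval (μ := fun _ : ι => μ) i).ae
        (enorm_ae_le_eLpNormEssSup (b i) μ)
    filter_upwards [ae_all_iff.2 h] with s hs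
    rw [real_enorm_prod]
    exact Finset.prod_le_prod' fun i _ => hs i
  · simp only [eLpNorm_eq_lintegral_rpow_enorm_toReal hp hp', real_enorm_prod,
      ← ENNReal.prod_rpow_of_nonneg ENNReal.toReal_nonneg]
    rw [lintegral_pi_prod_eq_prod (fun _ => μ) fun i => (hb i).enorm.pow_const _,
      ENNReal.prod_rpow_of_nonneg (by positivity)]

theorem memLp_pi_prod {ι : Type*} [Fintype ι] (μ : Measure X) [SigmaFinite μ]
    {b : ι → X → ℝ} {p : ℝ≥0∞} (hp : p ≠ 0) (hb : ∀ i, MemLp (b i) p μ) :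
    MemLp (fun s : ι → X => ∏ i, b i (s i)) p (Measure.pi fun _ => μ) :=
  ⟨aestronglyMeasurable_pi_prod μ fun i => (hb i).1,
    (eLpNorm_pi_prod_le μ hp fun i => (hb i).1).trans_lt
      (ENNReal.prod_lt_top fun i _ => (hb i).2)⟩

end ProductMeasures

/-! ### Integrating out some coordinates: Hölder bound and Fubini. -/

section Merge

variable {X : Type*} [MeasurableSpace X] {ι : Type*} [DecidableEq ι]

theorem prod_dite_mem_eq_prod {M : Type*} [CommMonoid M] {v u : Finset ι} (h : v ⊆ u)
    (F : v → M) : ∏ j : u, (if hj : (j : ι) ∈ v then F ⟨j, hj⟩ else 1) = ∏ i, F i := by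
  rw [Finset.prod_coe_sort u fun j => if hj : j ∈ v then F ⟨j, hj⟩ else 1,
    ← Finset.prod_subset h fun j _ hj => by simp [hj], ← Finset.prod_coe_sort]
  exact Finset.prod_congr rfl fun i _ => by simp

/-- Replace the coordinates in `v` of a point of `X^u` by those of a point of `X^v`. -/
def merge (v u : Finset ι) (z : (v → X) × (u → X)) : u → X :=
  fun j => if h : (j : ι) ∈ v then z.1 ⟨j, h⟩ else z.2 j

theorem measurable_merge (v u : Finset ι) : Measurable (merge (X := X) v u) := by
  refine measurable_pi_lambda _ fun j => ?_
  by_cases h : (j : ι) ∈ v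
  · simp only [merge, h, dite_true]; fun_prop
  · simp only [merge, h, dite_false]; fun_prop

/-- The second factor is all of `X^u` rather than `X^{u \ v}`; its overwritten coordinates are
harmless because `μ` has total mass one. -/
theorem measurePreserving_merge (μ : Measure X) [IsProbabilityMeasure μ] {v u : Finset ι}
    (h : v ⊆ u) : MeasurePreserving (merge v u)
      ((Measure.pi fun _ : v => μ).prod (Measure.pi fun _ : u => μ))
      (Measure.pi fun _ : u => μ) := by
  refine ⟨measurable_merge v u, (Measure.pi_eq fun s hs => ?_).symm⟩
  rw [Measure.map_apply (measurable_merge v u) (MeasurableSet.univ_pi hs)]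
  have : merge v u ⁻¹' (Set.univ.pi s) = (Set.univ.pi fun i : v => s ⟨i, h i.2⟩) ×ˢ
      (Set.univ.pi fun j : u => if (j : ι) ∈ v then Set.univ else s j) := by
    ext z
    simp only [Set.mem_preimage, Set.mem_univ_pi, Set.mem_prod, merge]
    constructor
    · intro hz
      refine ⟨fun i => by simpa using hz ⟨i, h i.2⟩, fun j => ?_⟩
      by_cases hj : (j : ι) ∈ v
      · simp [hj]
      · simpa [hj] using hz j
    · rintro ⟨h1, h2⟩ j
      by_cases hj : (j : ι) ∈ v
      · simpa [hj] using h1 ⟨j, hj⟩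
      · simpa [hj] using h2 j
  rw [this, Measure.prod_prod, Measure.pi_pi, Measure.pi_pi,
    ← prod_dite_mem_eq_prod h, ← Finset.prod_mul_distrib]
  refine Finset.prod_congr rfl fun j _ => ?_
  by_cases hj : (j : ι) ∈ v <;> simp [hj]

/-- Integrate out the coordinates in `u \ v` against a tensor power of `a`. -/
noncomputable def partialIntegral (μ : Measure X) (a : X → ℝ) (v u : Finset ι)
    (g : (u → X) → ℝ) (t : v → X) : ℝ :=
  ∫ s, g (merge v u (t, s)) * ∏ j : u, (if (j : ι) ∈ v then 1 else a (s j))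
    ∂(Measure.pi fun _ => μ)

/-- Tonelli for the `p`-th power; for `p = ∞` almost every section has essential supremum at most
the global one. -/
theorem eLpNorm_le_of_enorm_le_eLpNorm_section {Y Z : Type*} [MeasurableSpace Y]
    [MeasurableSpace Z] {μ : Measure Y} {ν : Measure Z} [SFinite μ] [SFinite ν] {p C : ℝ≥0∞}
    (hp : p ≠ 0) (hC : C ≠ ∞) {F : Y × Z → ℝ} (hF : AEStronglyMeasurable F (μ.prod ν))
    {G : Y → ℝ} (hG : ∀ᵐ t ∂μ, ‖G t‖ₑ ≤ C * eLpNorm (fun s => F (t, s)) p ν) :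
    eLpNorm G p μ ≤ C * eLpNorm F p (μ.prod ν) := by
  by_cases hp' : p = ∞
  · subst hp'
    simp only [eLpNorm_exponent_top] at hG ⊢
    refine eLpNormEssSup_le_of_ae_enorm_bound ?_
    filter_upwards [hG, Measure.ae_ae_of_ae_prod (enorm_ae_le_eLpNormEssSup F (μ.prod ν))]
      with t h1 h2
    exact h1.trans (mul_le_mul_right (eLpNormEssSup_le_of_ae_enorm_bound h2) _)
  · have hp0 : 0 < p.toReal := ENNReal.toReal_pos hp hp'
    simp only [eLpNorm_eq_lintegral_rpow_enorm_toReal hp hp'] at hG ⊢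
    have hC' : C = (C ^ p.toReal) ^ (1 / p.toReal) := by
      rw [← ENNReal.rpow_mul, mul_one_div_cancel hp0.ne', ENNReal.rpow_one]
    rw [hC', ← ENNReal.mul_rpow_of_nonneg _ _ (by positivity),
      lintegral_prod _ (hF.enorm.pow_const _), ← lintegral_const_mul' _ _ (by finiteness)]
    refine ENNReal.rpow_le_rpow (lintegral_mono_ae ?_) (by positivity)
    filter_upwards [hG] with t ht
    refine (ENNReal.rpow_le_rpow ht hp0.le).trans_eq ?_
    rw [ENNReal.mul_rpow_of_nonneg _ _ hp0.le, ← ENNReal.rpow_mul, one_div_mul_cancel hp0.ne',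
      ENNReal.rpow_one]

variable {μ : Measure X} [IsProbabilityMeasure μ] {p p' : ℝ≥0∞} {a : X → ℝ} {v u : Finset ι}
  {g : (u → X) → ℝ}

theorem memLp_mask (hp' : p' ≠ 0) (ha : MemLp a p' μ) :
    MemLp (fun s : u → X => ∏ j : u, (if (j : ι) ∈ v then 1 else a (s j))) p'
      (Measure.pi fun _ => μ) := by
  have := memLp_pi_prod μ (b := fun (j : u) x => if (j : ι) ∈ v then 1 else a x) hp' fun j => by
    by_cases hj : (j : ι) ∈ v
    · simpa [hj] using memLp_const 1
    · simpa [hj] using ha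
  exact this

theorem eLpNorm_mask_le (hp' : p' ≠ 0) (ha : MemLp a p' μ) :
    eLpNorm (fun s : u → X => ∏ j : u, (if (j : ι) ∈ v then 1 else a (s j))) p'
      (Measure.pi fun _ => μ) ≤ eLpNorm a p' μ ^ (u \ v).card := by
  refine (eLpNorm_pi_prod_le μ (b := fun (j : u) x => if (j : ι) ∈ v then 1 else a x) hp'
    fun j => ?_).trans_eq ?_
  · by_cases hj : (j : ι) ∈ v
    · simpa [hj] using aestronglyMeasurable_const
    · simpa [hj] using ha.1
  · rw [Finset.prod_coe_sort u fun j => eLpNorm (fun x => if j ∈ v then 1 else a x) p' μ,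
      ← Finset.prod_const, ← Finset.prod_subset Finset.sdiff_subset]
    · exact Finset.prod_congr rfl fun i hi => by simp [(Finset.mem_sdiff.1 hi).2]
    · intro x hx hx'
      have : x ∈ v := by simpa [hx] using hx'
      simp [this, eLpNorm_const _ hp' (IsProbabilityMeasure.ne_zero μ)]

theorem aestronglyMeasurable_partialIntegral (h : v ⊆ u) (ha : AEStronglyMeasurable a μ)
    (hg : AEStronglyMeasurable g (Measure.pi fun _ => μ)) :
    AEStronglyMeasurable (partialIntegral μ a v u g) (Measure.pi fun _ => μ) := by
  refine AEStronglyMeasurable.integral_prod_right' (f := fun z : (v → X) × (u → X) =>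
    g (merge v u z) * ∏ j : u, (if (j : ι) ∈ v then 1 else a (z.2 j))) ?_
  refine (hg.comp_measurePreserving (measurePreserving_merge μ h)).mul ?_
  have := aestronglyMeasurable_pi_prod μ (b := fun (j : u) x => if (j : ι) ∈ v then 1 else a x)
    fun j => by
      by_cases hj : (j : ι) ∈ v
      · simpa [hj] using aestronglyMeasurable_const
      · simpa [hj] using ha
  exact this.comp_snd

/-- Hölder in the integrated variables bounds the value at `t` by the `L_p` norm of a section, times
one factor `‖a‖_{p'}` for each coordinate in `u \ v`. Integrating over `t` and using that `merge`
preserves measure gives the claim. -/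
theorem eLpNorm_partialIntegral_le [p.HolderConjugate p'] (h : v ⊆ u) (hp : p ≠ 0)
    (hp' : p' ≠ 0) (ha : MemLp a p' μ) (hg : AEStronglyMeasurable g (Measure.pi fun _ => μ)) :
    eLpNorm (partialIntegral μ a v u g) p (Measure.pi fun _ => μ) ≤
      eLpNorm a p' μ ^ (u \ v).card * eLpNorm g p (Measure.pi fun _ => μ) := by
  have hm := measurePreserving_merge μ h
  have hg' := hg.comp_measurePreserving hm
  rw [← eLpNorm_comp_measurePreserving hg hm]
  refine eLpNorm_le_of_enorm_le_eLpNorm_section hp (ENNReal.pow_ne_top ha.2.ne) hg' ?_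
  filter_upwards [hg'.prodMk_left] with t ht
  calc ‖partialIntegral μ a v u g t‖ₑ
      ≤ eLpNorm ((fun s => (g ∘ merge v u) (t, s)) •
          fun s : u → X => ∏ j : u, (if (j : ι) ∈ v then 1 else a (s j))) 1
          (Measure.pi fun _ => μ) := by
        rw [eLpNorm_one_eq_lintegral_enorm]
        exact enorm_integral_le_lintegral_enorm _
    _ ≤ _ := eLpNorm_smul_le_mul_eLpNorm (memLp_mask hp' ha).1 ht
    _ ≤ _ := by
        rw [mul_comm]
        exact mul_le_mul_left (eLpNorm_mask_le hp' ha) _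

theorem integrable_mul_pi_prod [p.HolderConjugate p'] (hp' : p' ≠ 0) {ι : Type*} [Fintype ι]
    {g : (ι → X) → ℝ} {b : ι → X → ℝ} (hb : ∀ j, MemLp (b j) p' μ)
    (hg : MemLp g p (Measure.pi fun _ => μ)) :
    Integrable (fun s : ι → X => g s * ∏ j, b j (s j)) (Measure.pi fun _ => μ) :=
  hg.integrable_mul (memLp_pi_prod μ hp' hb)

/-- Pulled back along `merge`, the product splits into a factor in the kept coordinates and a factor
in the integrated ones, so Fubini applies. -/
theorem integral_partialIntegral_mul [p.HolderConjugate p'] (hp' : p' ≠ 0) (h : v ⊆ u)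
    (ha : MemLp a p' μ) {b : ι → X → ℝ} (hb : ∀ j, MemLp (b j) p' μ)
    (hg : MemLp g p (Measure.pi fun _ => μ)) :
    ∫ t : v → X, partialIntegral μ a v u g t * ∏ i : v, b i (t i) ∂(Measure.pi fun _ => μ) =
      ∫ s : u → X, g s * ∏ j : u, (if (j : ι) ∈ v then b j (s j) else a (s j))
        ∂(Measure.pi fun _ => μ) := by
  have hm := measurePreserving_merge μ h
  have hI : Integrable (fun s : u → X => g s * ∏ j : u,
      (if (j : ι) ∈ v then b j (s j) else a (s j))) (Measure.pi fun _ => μ) := by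
    have := integrable_mul_pi_prod (p := p) hp'
      (b := fun (j : u) x => if (j : ι) ∈ v then b j x else a x) (fun j => by
        by_cases hj : (j : ι) ∈ v
        · simpa [hj] using hb j
        · simpa [hj] using ha) hg
    exact this
  have hI' := hm.integrable_comp_of_integrable hI
  have key : ∀ z : (v → X) × (u → X),
      ∏ j : u, (if (j : ι) ∈ v then b j (merge v u z j) else a (merge v u z j)) =
      (∏ i : v, b i (z.1 i)) * ∏ j : u, (if (j : ι) ∈ v then 1 else a (z.2 j)) := by
    intro z
    rw [← prod_dite_mem_eq_prod h, ← Finset.prod_mul_distrib]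
    refine Finset.prod_congr rfl fun j _ => ?_
    by_cases hj : (j : ι) ∈ v <;> simp [hj, merge]
  have hmap := hm.map_eq
  rw [← hmap] at hI ⊢
  rw [integral_map hm.measurable.aemeasurable hI.1]
  refine Eq.trans ?_ (integral_prod _ hI').symm
  refine integral_congr_ae (.of_forall fun t => ?_)
  simp only [Function.comp_def, key, partialIntegral]
  rw [← integral_mul_const]
  exact integral_congr_ae (.of_forall fun s => by ring)

end Merge

/-! ### The probability measure `ψ dt` and the integrability of the kernels. -/

section DensityMeasure

/-- The probability measure on `ℝ` with density `ψ` on `D`. -/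
noncomputable def densityMeasure (D : Set ℝ) (ψ : ℝ → ℝ) : Measure ℝ :=
  (volume.restrict D).withDensity fun t => ENNReal.ofReal (ψ t)

variable {D : Set ℝ} {ψ : ℝ → ℝ} {p : ℝ≥0∞}

theorem IsDensity.isProbabilityMeasure (hψ : IsDensity D ψ) :
    IsProbabilityMeasure (densityMeasure D ψ) :=
  ⟨by rw [densityMeasure, withDensity_apply _ .univ, Measure.restrict_univ, hψ.lintegral_eq_one]⟩

theorem densityMeasure_ac : densityMeasure D ψ ≪ volume.restrict D :=
  withDensity_absolutelyContinuous _ _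

theorem IsDensity.ac_densityMeasure (hψ : IsDensity D ψ) :
    volume.restrict D ≪ densityMeasure D ψ :=
  withDensity_absolutelyContinuous' hψ.aemeasurable.ennreal_ofReal <| by
    filter_upwards [hψ.pos_ae] with t ht
    simpa using ht

theorem volume_restrict_cube {d : ℕ} (u : Finset (Fin d)) :
    volume.restrict (cube D u) = Measure.pi fun _ : u => volume.restrict D := by
  rw [cube, volume_pi, Measure.restrict_pi_pi]

theorem IsDensity.ae_cube_pos (hψ : IsDensity D ψ) {d : ℕ} (u : Finset (Fin d)) :
    ∀ᵐ t ∂(volume.restrict (cube D u)), ∀ j, 0 < ψ (t j) := by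
  rw [volume_restrict_cube]
  exact ae_all_iff.2 fun j =>
    (Measure.quasiMeasurePreserving_eval (μ := fun _ : u => volume.restrict D) j).ae hψ.pos_ae

theorem IsDensity.weightedMeasure_eq_pi (hψ : IsDensity D ψ) {d : ℕ} (u : Finset (Fin d)) :
    weightedMeasure D ψ u = Measure.pi fun _ => densityMeasure D ψ := by
  have := hψ.isProbabilityMeasure
  symm
  refine Measure.pi_eq fun s hs => ?_
  have h : weightedMeasure D ψ u =
      (volume.restrict (cube D u)).withDensity fun t => ∏ j, ENNReal.ofReal (ψ (t j)) :=
    withDensity_congr_ae <| by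
      filter_upwards [hψ.ae_cube_pos u] with t ht
      rw [ENNReal.ofReal_prod_of_nonneg fun j _ => (ht j).le]
  rw [h, withDensity_apply _ (MeasurableSet.univ_pi hs), volume_restrict_cube,
    Measure.restrict_pi_pi, lintegral_pi_prod_eq_prod (fun i => (volume.restrict D).restrict (s i))
      (f := fun _ x => ENNReal.ofReal (ψ x))]
  · exact Finset.prod_congr rfl fun i _ => (withDensity_apply _ (hs i)).symm
  · exact fun i => hψ.aemeasurable.ennreal_ofReal.restrict

theorem IsDensity.smoothing_eq (hψ : IsDensity D ψ) (k : Kind) {d : ℕ} (u : Finset (Fin d))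
    (g : (u → ℝ) → ℝ) (x : Fin d → D) :
    smoothing D ψ k u g x =
      ∫ t, g t * ∏ j : u, (kernel D ψ k (x j) (t j) / ψ (t j))
        ∂(Measure.pi fun _ => densityMeasure D ψ) := by
  have hm : AEMeasurable (fun t : u → ℝ => ENNReal.ofReal (∏ j, ψ (t j)))
      (volume.restrict (cube D u)) := by
    rw [volume_restrict_cube]
    exact (Finset.aemeasurable_fun_prod _ fun i _ => hψ.aemeasurable.comp_quasiMeasurePreserving
      (Measure.quasiMeasurePreserving_eval (μ := fun _ : u => volume.restrict D) i)).ennreal_ofReal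
  rw [← hψ.weightedMeasure_eq_pi, weightedMeasure,
    integral_withDensity_eq_integral_toReal_smul₀ hm (by simp), smoothing]
  refine integral_congr_ae ?_
  filter_upwards [hψ.ae_cube_pos u] with t ht
  have h0 : 0 < ∏ j, ψ (t j) := Finset.prod_pos fun j _ => ht j
  rw [ENNReal.toReal_ofReal h0.le, Finset.prod_div_distrib, smul_eq_mul]
  field_simp

/-- Since `p'/p = p' - 1`, one has `|f/ψ|^{p'} ψ = |f ψ^{-1/p}|^{p'}` where `ψ > 0`. Lebesgue
integrability conditions thus become conditions under `ψ dt`. -/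
theorem IsDensity.memLp_div (hψ : IsDensity D ψ) (hp : 1 ≤ p) {f : ℝ → ℝ}
    (hf : MemLp (fun t => f t * ψ t ^ (-(p⁻¹.toReal))) p.conjExponent (volume.restrict D)) :
    MemLp (fun t => f t / ψ t) p.conjExponent (densityMeasure D ψ) := by
  set s := p⁻¹.toReal with hs
  set p' := p.conjExponent with hp'
  have hconj : p.HolderConjugate p' := ENNReal.HolderConjugate.conjExponent hp
  have hp'0 : p' ≠ 0 := ENNReal.HolderConjugate.ne_zero p' p
  have hpinv : p⁻¹ ≠ ∞ := by
    simpa using (zero_lt_one.trans_le hp).ne'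
  have hfm : AEStronglyMeasurable (fun t => f t / ψ t) (volume.restrict D) := by
    -- Measurability of `f` is not given, so `f/ψ` is recovered as `(f ψ^{-s}) ψ^{s-1}`.
    refine (hf.1.mul (hψ.aemeasurable.pow_const (s - 1)).aestronglyMeasurable).congr ?_
    filter_upwards [hψ.pos_ae] with t ht
    simp only [Pi.mul_apply]
    rw [mul_assoc, ← Real.rpow_add ht, div_eq_mul_inv, ← Real.rpow_neg_one]
    ring_nf
  refine ⟨hfm.mono_ac densityMeasure_ac, ?_⟩
  by_cases htop : p' = ∞
  · have hs1 : s = 1 := by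
      have := ENNReal.HolderConjugate.inv_add_inv_eq_one p p'
      rw [htop] at this
      simp at this
      simp [hs, this]
    have h2 := hf.2
    rw [htop] at h2 ⊢
    rw [eLpNorm_exponent_top] at h2 ⊢
    refine (eLpNormEssSup_mono_measure _ densityMeasure_ac).trans_lt (lt_of_le_of_lt ?_ h2)
    refine (eLpNormEssSup_congr_ae ?_).le
    filter_upwards with t
    rw [hs1, Real.rpow_neg_one, div_eq_mul_inv]
  · have hr0 : 0 < p'.toReal := ENNReal.toReal_pos hp'0 htop
    have hrs : p'.toReal * s = p'.toReal - 1 := by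
      have h1 := congrArg ENNReal.toReal (ENNReal.HolderConjugate.inv_add_inv_eq_one p p')
      rw [ENNReal.toReal_add hpinv (by simpa using hp'0), ← hs, ENNReal.toReal_inv p'] at h1
      simp only [ENNReal.toReal_one] at h1
      have : s = 1 - p'.toReal⁻¹ := by linarith
      rw [this]
      field_simp
    refine lt_of_le_of_lt (le_of_eq ?_) hf.2
    rw [eLpNorm_eq_lintegral_rpow_enorm_toReal hp'0 htop,
      eLpNorm_eq_lintegral_rpow_enorm_toReal hp'0 htop, densityMeasure,
      lintegral_withDensity_eq_lintegral_mul₀ hψ.aemeasurable.ennreal_ofReal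
        (hfm.enorm.pow_const _)]
    congr 1
    refine lintegral_congr_ae ?_
    filter_upwards [hψ.pos_ae] with t ht
    simp only [Pi.mul_apply, Real.enorm_eq_ofReal_abs]
    rw [ENNReal.ofReal_rpow_of_nonneg (abs_nonneg _) hr0.le,
      ENNReal.ofReal_rpow_of_nonneg (abs_nonneg _) hr0.le, ← ENNReal.ofReal_mul ht.le, abs_div,
      abs_mul, abs_of_pos ht, abs_of_pos (Real.rpow_pos_of_pos ht _),
      Real.div_rpow (abs_nonneg _) ht.le, Real.mul_rpow (abs_nonneg _) (by positivity),
      ← Real.rpow_mul ht.le]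
    congr 1
    have : -s * p'.toReal = 1 - p'.toReal := by linarith
    rw [this, Real.rpow_sub ht, Real.rpow_one]
    ring

theorem IsBaseInterval.measurableSet (hD : IsBaseInterval D) : MeasurableSet D :=
  hD.ordConnected.measurableSet

theorem IsBaseInterval.Ico_subset (hD : IsBaseInterval D) {x : ℝ} (hx : x ∈ D) :
    Set.Ico 0 x ⊆ D :=
  Set.Ico_subset_Icc_self.trans (hD.ordConnected.out hD.isLeast_zero.1 hx)

/-- For `p = ∞` the extra factor is `ψ^0 = 1` and `p' = 1`, so the two alternatives share one form.
-/
theorem KernelCondition.memLp_tail_mul (h : KernelCondition D ψ p) :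
    MemLp (fun t => tail D ψ t * ψ t ^ (-(p⁻¹.toReal))) p.conjExponent (volume.restrict D) := by
  rcases h with ⟨rfl, h⟩ | ⟨-, -, h⟩
  · simpa [ENNReal.conjExponent, memLp_one_iff_integrable, IntegrableOn] using h
  · exact h

theorem KernelCondition.memLp_tail (h : KernelCondition D ψ p) (hψ : IsDensity D ψ)
    (hp : 1 ≤ p) :
    MemLp (fun t => tail D ψ t / ψ t) p.conjExponent (densityMeasure D ψ) :=
  hψ.memLp_div hp h.memLp_tail_mul

theorem KernelCondition.memLp_kernel (h : KernelCondition D ψ p) (hD : IsBaseInterval D)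
    (hψ : IsDensity D ψ) (hp : 1 ≤ p) (k : Kind) {x : ℝ} (hx : x ∈ D) :
    MemLp (fun t => kernel D ψ k x t / ψ t) p.conjExponent (densityMeasure D ψ) := by
  have hanch : MemLp (fun t => kernel D ψ .anchored x t / ψ t) p.conjExponent
      (densityMeasure D ψ) := by
    refine hψ.memLp_div hp ?_
    have : MemLp (fun t => ψ t ^ (-(p⁻¹.toReal))) p.conjExponent
        (volume.restrict (Set.Ico 0 x)) := by
      rcases h with ⟨rfl, h⟩ | ⟨-, h, -⟩
      · simpa using memLp_const (1 : ℝ)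
      · exact h x hx
    rw [← Set.inter_eq_self_of_subset_left (hD.Ico_subset hx),
      ← Measure.restrict_restrict measurableSet_Ico,
      ← memLp_indicator_iff_restrict measurableSet_Ico] at this
    refine this.congr_norm this.1 (.of_forall fun t => ?_) |>.ae_eq (.of_forall fun t => ?_)
    · rfl
    · by_cases ht : t ∈ Set.Ico 0 x <;> simp [kernel, ht, Set.indicator]
  cases k with
  | anchored => exact hanch
  | anova =>
    refine (hanch.sub (h.memLp_tail hψ hp)).ae_eq (.of_forall fun t => ?_)
    simp [kernel, sub_div]

/-- The integral is `∫_D ψ̄`, the constant that drives the lower bound. It is positive because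
`ψ̄(t) ≥ ∫_t^b ψ > 0` for `0 < t < b`, with any `b ∈ D`, `b ≠ 0`. -/
theorem KernelCondition.integral_tail_pos (h : KernelCondition D ψ p) (hD : IsBaseInterval D)
    (hψ : IsDensity D ψ) (hp : 1 ≤ p) :
    0 < ∫ t, tail D ψ t / ψ t ∂(densityMeasure D ψ) := by
  have := hψ.isProbabilityMeasure
  have h1 : 1 ≤ p.conjExponent := by simp [ENNReal.conjExponent]
  have hint := (h.memLp_tail hψ hp).integrable h1
  have hnn : ∀ t, 0 ≤ tail D ψ t := fun t =>
    setIntegral_nonneg (hD.measurableSet.inter measurableSet_Ioi) fun y hy => hψ.nonneg y hy.1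
  have hψint : IntegrableOn ψ D := by
    refine ⟨hψ.aemeasurable.aestronglyMeasurable, ?_⟩
    rw [hasFiniteIntegral_iff_ofReal, hψ.lintegral_eq_one]
    · simp
    · filter_upwards [hψ.pos_ae] with t ht using ht.le
  obtain ⟨b, hb, hb0⟩ := hD.nontrivial.exists_ne 0
  have hb0 : 0 < b := lt_of_le_of_ne (hD.isLeast_zero.2 hb) hb0.symm
  have htail : ∀ t ∈ Set.Ioo 0 b, 0 < tail D ψ t := by
    intro t ht
    rw [tail, setIntegral_pos_iff_support_of_nonneg_ae]
    · have hsub : ∀ᵐ y, y ∈ Set.Ioo t b → y ∈ Function.support ψ ∩ (D ∩ Set.Ioi t) := by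
        filter_upwards [(ae_restrict_iff' hD.measurableSet).1 hψ.pos_ae] with y hy hyt
        have hyD : y ∈ D := hD.Ico_subset hb ⟨(ht.1.trans hyt.1).le, hyt.2⟩
        exact ⟨(hy hyD).ne', hyD, hyt.1⟩
      refine lt_of_lt_of_le ?_ (measure_mono_ae (s := Set.Ioo t b) hsub)
      simpa using ht.2
    · exact ae_restrict_of_forall_mem (hD.measurableSet.inter measurableSet_Ioi)
        fun y hy => hψ.nonneg y hy.1
    · exact hψint.mono_set Set.inter_subset_left
  rw [integral_pos_iff_support_of_nonneg_ae _ hint]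
  · refine pos_iff_ne_zero.2 fun h0 => ?_
    have h0' := hψ.ac_densityMeasure h0
    rw [Measure.restrict_apply₀' hD.measurableSet.nullMeasurableSet] at h0'
    have hsub : ∀ᵐ y, y ∈ Set.Ioo 0 b →
        y ∈ (Function.support fun t => tail D ψ t / ψ t) ∩ D := by
      filter_upwards [(ae_restrict_iff' hD.measurableSet).1 hψ.pos_ae] with y hy hyt
      have hyD : y ∈ D := hD.Ico_subset hb ⟨hyt.1.le, hyt.2⟩
      exact ⟨(div_pos (htail y hyt) (hy hyD)).ne', hyD⟩
    have := (measure_mono_ae (s := Set.Ioo 0 b) hsub).trans_eq h0'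
    simp [hb0.not_ge] at this
  · filter_upwards [densityMeasure_ac.ae_le hψ.pos_ae] with t ht
    exact div_nonneg (hnn t) ht.le

end DensityMeasure

/-! ### Injectivity of the anchored integral transform. -/

section Uniqueness

variable {D : Set ℝ} {ψ : ℝ → ℝ} {p : ℝ≥0∞}

/-- Only a maximum of `D`, a single point if it exists, has to be excluded. -/
theorem IsBaseInterval.ae_exists_rat_gt (hD : IsBaseInterval D) :
    ∀ᵐ t : ℝ ∂(volume.restrict D), 0 ≤ t ∧ ∃ q : ℚ, (q : ℝ) ∈ D ∧ t < q := by
  have hnull : volume {t : ℝ | t ∈ D ∧ ∀ y ∈ D, y ≤ t} = 0 :=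
    Set.Subsingleton.measure_zero (fun s hs t ht => le_antisymm (ht.2 s hs.1) (hs.2 t ht.1)) _
  rw [ae_restrict_iff' hD.measurableSet]
  filter_upwards [measure_eq_zero_iff_ae_notMem.1 hnull] with t ht htD
  refine ⟨hD.isLeast_zero.2 htD, ?_⟩
  have : ∃ y ∈ D, t < y := by
    by_contra! h
    exact ht ⟨htD, h⟩
  obtain ⟨y, hy, hty⟩ := this
  obtain ⟨q, hq1, hq2⟩ := exists_rat_btwn hty
  exact ⟨q, hD.ordConnected.out htD hy ⟨hq1.le, hq2.le⟩, hq1⟩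

theorem ae_eq_zero_of_forall_setIntegral_pi_Iio {ι : Type*} [Finite ι] {ν : Measure (ι → ℝ)}
    {H : (ι → ℝ) → ℝ} (hH : Integrable H ν) (huniv : ∫ t, H t ∂ν = 0)
    (hbox : ∀ y : ι → ℝ, ∫ t in Set.univ.pi fun i => Set.Iio (y i), H t ∂ν = 0) :
    H =ᵐ[ν] 0 := by
  refine hH.ae_eq_zero_of_forall_setIntegral_eq_zero fun s hs hfin => ?_
  -- Finiteness of `ν s` does not pass to complements, so it is dropped before the π-λ induction.
  clear hfin
  have hgen : (MeasurableSpace.pi : MeasurableSpace (ι → ℝ)) = MeasurableSpace.generateFrom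
      (Set.univ.pi '' Set.univ.pi fun _ : ι => Set.range (Set.Iio : ℝ → Set ℝ)) := by
    refine (generateFrom_eq_pi (fun _ => ?_) fun _ => ?_).symm
    · exact (borel_eq_generateFrom_Iio ℝ).symm.trans BorelSpace.measurable_eq.symm
    · refine ⟨fun n : ℕ => Set.Iio (n : ℝ), fun n => ⟨_, rfl⟩, ?_⟩
      exact Set.eq_univ_of_forall fun t => Set.mem_iUnion.2 (exists_nat_gt t)
  induction s, hs using MeasurableSpace.induction_on_inter hgen
    (IsPiSystem.pi fun _ => isPiSystem_Iio) with
  | empty => simp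
  | basic s hs =>
    obtain ⟨S, hS, rfl⟩ := hs
    choose y hy using fun i => hS i (Set.mem_univ i)
    simpa [hy] using hbox y
  | compl s hs ih =>
    have := integral_add_compl hs hH
    rwa [ih, huniv, zero_add] at this
  | iUnion f hd hf ih =>
    rw [integral_iUnion hf hd hH.integrableOn]
    simp [ih]

/-- Cutting the integrand for `x` to a box below `y` gives the integrand for the smaller point `max
0 (min x y)`, which also lies in `D^ι`. All box integrals therefore vanish, and so does the
integrand almost everywhere. Countably many rational `x` suffice, since almost every `t` lies
strictly below one of them, where no kernel factor vanishes. -/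
theorem KernelCondition.ae_eq_zero_of_integral_anchored_eq_zero (h : KernelCondition D ψ p)
    (hD : IsBaseInterval D) (hψ : IsDensity D ψ) (hp : 1 ≤ p) {ι : Type*} [Fintype ι]
    {w : (ι → ℝ) → ℝ} (hw : MemLp w p (Measure.pi fun _ => densityMeasure D ψ))
    (hzero : ∀ x : ι → ℝ, (∀ j, x j ∈ D) →
      ∫ t, w t * ∏ j, (kernel D ψ .anchored (x j) (t j) / ψ (t j))
        ∂(Measure.pi fun _ => densityMeasure D ψ) = 0) :
    w =ᵐ[Measure.pi fun _ => densityMeasure D ψ] 0 := by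
  have := hψ.isProbabilityMeasure
  have hconj : p.HolderConjugate p.conjExponent := ENNReal.HolderConjugate.conjExponent hp
  have hp'0 : p.conjExponent ≠ 0 := ENNReal.HolderConjugate.ne_zero p.conjExponent p
  have hX : ∀ x : ι → ℝ, (∀ j, x j ∈ D) →
      (fun t => w t * ∏ j, (kernel D ψ .anchored (x j) (t j) / ψ (t j)))
        =ᵐ[Measure.pi fun _ => densityMeasure D ψ] 0 := by
    intro x hx
    refine ae_eq_zero_of_forall_setIntegral_pi_Iio
      (integrable_mul_pi_prod (p := p) hp'0
        (b := fun j s => kernel D ψ .anchored (x j) s / ψ s)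
        (fun j => h.memLp_kernel hD hψ hp _ (hx j)) hw) (hzero x hx) fun y => ?_
    rw [← integral_indicator (MeasurableSet.univ_pi fun _ => measurableSet_Iio),
      -- The maximum with `0` keeps the point in `D` when `y j < 0`; the interval `[0, 0)` is then
      -- empty, as is the cut.
      ← hzero (fun j => max 0 (min (x j) (y j))) fun j => ?_]
    · refine integral_congr_ae (.of_forall fun t => ?_)
      by_cases ht : t ∈ Set.univ.pi fun i => Set.Iio (y i)
      · rw [Set.indicator_of_mem ht]
        congr 1
        refine Finset.prod_congr rfl fun j _ => ?_
        have hj : t j < y j := ht j trivial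
        by_cases h0 : 0 ≤ t j
        · by_cases h1 : t j < x j <;> simp [kernel, Set.indicator, h0, h1, hj, h0.not_gt]
        · simp [kernel, Set.indicator, h0]
      · rw [Set.indicator_of_notMem ht]
        simp only [Set.mem_univ_pi, Set.mem_Iio, not_forall, not_lt] at ht
        obtain ⟨j, hj⟩ := ht
        have : t j ∉ Set.Ico 0 (max 0 (min (x j) (y j))) := by
          rintro ⟨h0, h1⟩
          rcases lt_max_iff.1 h1 with h2 | h2
          · exact h2.not_ge h0
          · exact (lt_min_iff.1 h2).2.not_ge hj
        refine (mul_eq_zero_of_right _ (Finset.prod_eq_zero (Finset.mem_univ j) ?_)).symm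
        simp [kernel, Set.indicator_of_notMem this]
    · refine hD.ordConnected.out hD.isLeast_zero.1 (hx j) ⟨le_max_left _ _, max_le ?_ ?_⟩
      · exact hD.isLeast_zero.2 (hx j)
      · exact min_le_left _ _
  have hcount : ∀ᵐ t ∂(Measure.pi fun _ : ι => densityMeasure D ψ), ∀ x : ι → ℚ,
      (∀ j, (x j : ℝ) ∈ D) →
        w t * ∏ j, (kernel D ψ .anchored (x j) (t j) / ψ (t j)) = 0 := by
    refine ae_all_iff.2 fun x => ?_
    by_cases hx : ∀ j, (x j : ℝ) ∈ D
    · filter_upwards [hX _ hx] with t ht _ using ht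
    · exact .of_forall fun t h' => absurd h' hx
  have hcoord : ∀ᵐ t ∂(Measure.pi fun _ : ι => densityMeasure D ψ), ∀ j,
      0 < ψ (t j) ∧ 0 ≤ t j ∧ ∃ q : ℚ, (q : ℝ) ∈ D ∧ t j < (q : ℝ) :=
    ae_all_iff.2 fun j =>
      (Measure.quasiMeasurePreserving_eval (μ := fun _ : ι => densityMeasure D ψ) j).ae
        (densityMeasure_ac.ae_le (hψ.pos_ae.and hD.ae_exists_rat_gt))
  filter_upwards [hcount, hcoord] with t h1 h2
  choose q hq hqt using fun j => (h2 j).2.2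
  refine (mul_eq_zero.1 (h1 q hq)).resolve_right (Finset.prod_ne_zero_iff.2 fun j _ => ?_)
  have : t j ∈ Set.Ico 0 (q j : ℝ) := ⟨(h2 j).2.1, hqt j⟩
  simp [kernel, this, (h2 j).1.ne']

end Uniqueness

/-! ### Change of components between the two decompositions, and their uniqueness. -/

section Transform

theorem prod_add_coe_sort {ι : Type*} [DecidableEq ι] {u : Finset ι} (f g : u → ℝ) :
    ∏ j, (f j + g j) = ∑ v ∈ u.powerset, ∏ j : u, (if (j : ι) ∈ v then f j else g j) := by
  let F : ι → ℝ := fun i => if h : i ∈ u then f ⟨i, h⟩ else 0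
  let G : ι → ℝ := fun i => if h : i ∈ u then g ⟨i, h⟩ else 0
  have hF : ∀ j : u, F j = f j := fun j => by simp [F]
  have hG : ∀ j : u, G j = g j := fun j => by simp [G]
  simp only [← hF, ← hG]
  rw [Finset.prod_coe_sort u fun i => F i + G i, Finset.prod_add]
  refine Finset.sum_congr rfl fun v hv => ?_
  rw [Finset.prod_coe_sort u fun i => if i ∈ v then F i else G i, Finset.prod_ite,
    Finset.filter_mem_eq_inter, Finset.inter_eq_right.2 (Finset.mem_powerset.1 hv),
    Finset.sdiff_eq_filter]

/-- The other type of decomposition. -/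
def Kind.swap : Kind → Kind
  | .anchored => .anova
  | .anova => .anchored

@[simp] theorem Kind.swap_swap (k : Kind) : k.swap.swap = k := by cases k <;> rfl

/-- The coefficient of the tail in the difference of the kernels. -/
def Kind.sign : Kind → ℝ
  | .anchored => 1
  | .anova => -1

theorem Kind.sign_swap (k : Kind) : k.swap.sign = -k.sign := by cases k <;> simp [swap, sign]

theorem Kind.enorm_sign (k : Kind) : ‖k.sign‖ₑ = 1 := by cases k <;> simp [sign]

theorem kernel_eq_swap_add (D : Set ℝ) (ψ : ℝ → ℝ) (k : Kind) (x t : ℝ) :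
    kernel D ψ k x t = kernel D ψ k.swap x t + k.sign * tail D ψ t := by
  cases k <;> simp [kernel, Kind.swap, Kind.sign, sub_eq_add_neg]

/-- The components of type `k.swap` in terms of the components of type `k`. -/
noncomputable def transform (D : Set ℝ) (ψ : ℝ → ℝ) (k : Kind) {d : ℕ}
    (g : (u : Finset (Fin d)) → (u → ℝ) → ℝ) (v : Finset (Fin d)) : (v → ℝ) → ℝ :=
  ∑ u with v ⊆ u,
    partialIntegral (densityMeasure D ψ) (fun t => k.sign * (tail D ψ t / ψ t)) v u (g u)

variable {D : Set ℝ} {ψ : ℝ → ℝ} {p : ℝ≥0∞}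

/-- The assumptions on the interval, the density and the integrability exponent. -/
structure IsAdmissible (D : Set ℝ) (ψ : ℝ → ℝ) (p : ℝ≥0∞) : Prop where
  interval : IsBaseInterval D
  density : IsDensity D ψ
  one_le : 1 ≤ p
  kernelCondition : KernelCondition D ψ p

/-- The norm of the functional `h ↦ ∫ ψ̄ h` on `L_{p,ψ}(D)`. -/
noncomputable def tailNorm (D : Set ℝ) (ψ : ℝ → ℝ) (p : ℝ≥0∞) : ℝ≥0∞ :=
  eLpNorm (fun t => tail D ψ t / ψ t) p.conjExponent (densityMeasure D ψ)

namespace IsAdmissible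

theorem isProbabilityMeasure (H : IsAdmissible D ψ p) :
    IsProbabilityMeasure (densityMeasure D ψ) := H.density.isProbabilityMeasure

theorem holderConjugate (H : IsAdmissible D ψ p) : p.HolderConjugate p.conjExponent :=
  ENNReal.HolderConjugate.conjExponent H.one_le

theorem ne_zero (H : IsAdmissible D ψ p) : p ≠ 0 := (zero_lt_one.trans_le H.one_le).ne'

theorem conj_ne_zero (_H : IsAdmissible D ψ p) : p.conjExponent ≠ 0 := by
  simp [ENNReal.conjExponent]

theorem memLp_tail (H : IsAdmissible D ψ p) :
    MemLp (fun t => tail D ψ t / ψ t) p.conjExponent (densityMeasure D ψ) :=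
  H.kernelCondition.memLp_tail H.density H.one_le

theorem memLp_kernel (H : IsAdmissible D ψ p) (k : Kind) (x : D) :
    MemLp (fun t => kernel D ψ k x t / ψ t) p.conjExponent (densityMeasure D ψ) :=
  H.kernelCondition.memLp_kernel H.interval H.density H.one_le k x.2

theorem tailNorm_lt_top (H : IsAdmissible D ψ p) : tailNorm D ψ p < ∞ := H.memLp_tail.2

theorem memLp_sign_mul_tail (H : IsAdmissible D ψ p) (k : Kind) :
    MemLp (fun t => k.sign * (tail D ψ t / ψ t)) p.conjExponent (densityMeasure D ψ) :=
  H.memLp_tail.const_mul _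

variable {d : ℕ} {u v : Finset (Fin d)} {γ : Finset (Fin d) → ℝ≥0} {k : Kind}
  {f : (Fin d → D) → ℝ} {g h : (u : Finset (Fin d)) → (u → ℝ) → ℝ}

theorem memLp_iff (H : IsAdmissible D ψ p) {w : (u → ℝ) → ℝ} :
    MemLp w p (weightedMeasure D ψ u) ↔ MemLp w p (Measure.pi fun _ => densityMeasure D ψ) := by
  rw [H.density.weightedMeasure_eq_pi]

theorem integrable_smoothing (H : IsAdmissible D ψ p) (k : Kind) (x : Fin d → D)
    {w : (u → ℝ) → ℝ} (hw : MemLp w p (weightedMeasure D ψ u)) :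
    Integrable (fun t => w t * ∏ j : u, (kernel D ψ k (x j) (t j) / ψ (t j)))
      (Measure.pi fun _ => densityMeasure D ψ) := by
  have := H.isProbabilityMeasure
  have := H.holderConjugate
  exact integrable_mul_pi_prod (p := p) H.conj_ne_zero
    (b := fun (j : u) s => kernel D ψ k (x j) s / ψ s) (fun j => H.memLp_kernel k (x j))
    (H.memLp_iff.1 hw)

theorem smoothing_sub (H : IsAdmissible D ψ p) (k : Kind) (x : Fin d → D) {w w' : (u → ℝ) → ℝ}
    (hw : MemLp w p (weightedMeasure D ψ u)) (hw' : MemLp w' p (weightedMeasure D ψ u)) :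
    smoothing D ψ k u (w - w') x = smoothing D ψ k u w x - smoothing D ψ k u w' x := by
  simp only [H.density.smoothing_eq]
  rw [← integral_sub (H.integrable_smoothing k x hw) (H.integrable_smoothing k x hw')]
  simp [sub_mul]

theorem smoothing_sum (H : IsAdmissible D ψ p) (k : Kind) (x : Fin d → D) {ι : Type*}
    (s : Finset ι) {w : ι → (u → ℝ) → ℝ} (hw : ∀ i ∈ s, MemLp (w i) p (weightedMeasure D ψ u)) :
    smoothing D ψ k u (∑ i ∈ s, w i) x = ∑ i ∈ s, smoothing D ψ k u (w i) x := by
  simp only [H.density.smoothing_eq]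
  rw [← integral_finsetSum _ fun i hi => H.integrable_smoothing k x (hw i hi)]
  simp [Finset.sum_mul]

theorem smoothing_congr (H : IsAdmissible D ψ p) (k : Kind) (x : Fin d → D)
    {w w' : (u → ℝ) → ℝ} (hw : w =ᵐ[weightedMeasure D ψ u] w') :
    smoothing D ψ k u w x = smoothing D ψ k u w' x := by
  rw [H.density.weightedMeasure_eq_pi] at hw
  simp only [H.density.smoothing_eq]
  refine integral_congr_ae ?_
  filter_upwards [hw] with t ht
  rw [ht]

theorem eLpNorm_partialIntegral_le (H : IsAdmissible D ψ p) (k : Kind) (hvu : v ⊆ u)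
    {w : (u → ℝ) → ℝ} (hw : MemLp w p (weightedMeasure D ψ u)) :
    eLpNorm (partialIntegral (densityMeasure D ψ) (fun t => k.sign * (tail D ψ t / ψ t)) v u w)
        p (weightedMeasure D ψ v) ≤
      tailNorm D ψ p ^ (u \ v).card * eLpNorm w p (weightedMeasure D ψ u) := by
  have := H.isProbabilityMeasure
  have := H.holderConjugate
  have hn : eLpNorm (fun t => k.sign * (tail D ψ t / ψ t)) p.conjExponent (densityMeasure D ψ) =
      tailNorm D ψ p := by
    have := eLpNorm_const_smul k.sign (fun t => tail D ψ t / ψ t) p.conjExponent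
      (densityMeasure D ψ)
    rwa [k.enorm_sign, one_mul] at this
  rw [H.memLp_iff] at hw
  rw [H.density.weightedMeasure_eq_pi, H.density.weightedMeasure_eq_pi, ← hn]
  exact AnchoredAnova.eLpNorm_partialIntegral_le hvu H.ne_zero H.conj_ne_zero
    (H.memLp_sign_mul_tail k) hw.1

theorem memLp_partialIntegral (H : IsAdmissible D ψ p) (k : Kind) (hvu : v ⊆ u)
    {w : (u → ℝ) → ℝ} (hw : MemLp w p (weightedMeasure D ψ u)) :
    MemLp (partialIntegral (densityMeasure D ψ) (fun t => k.sign * (tail D ψ t / ψ t)) v u w)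
        p (weightedMeasure D ψ v) := by
  have := H.isProbabilityMeasure
  refine ⟨?_, (H.eLpNorm_partialIntegral_le k hvu hw).trans_lt
    (ENNReal.mul_lt_top (ENNReal.pow_lt_top H.tailNorm_lt_top) hw.2)⟩
  rw [H.density.weightedMeasure_eq_pi]
  exact aestronglyMeasurable_partialIntegral hvu (H.memLp_sign_mul_tail k).1 (H.memLp_iff.1 hw).1

theorem partialIntegral_ae_eq_zero (H : IsAdmissible D ψ p) (k : Kind) (hvu : v ⊆ u)
    {w : (u → ℝ) → ℝ} (hw : MemLp w p (weightedMeasure D ψ u))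
    (hw0 : w =ᵐ[weightedMeasure D ψ u] 0) :
    partialIntegral (densityMeasure D ψ) (fun t => k.sign * (tail D ψ t / ψ t)) v u w
      =ᵐ[weightedMeasure D ψ v] 0 := by
  rw [← eLpNorm_eq_zero_iff (H.memLp_partialIntegral k hvu hw).1 H.ne_zero]
  have := H.eLpNorm_partialIntegral_le k hvu hw
  rw [(eLpNorm_eq_zero_iff hw.1 H.ne_zero).2 hw0, mul_zero] at this
  exact le_antisymm this bot_le

/-- Each factor is the swapped kernel plus a signed tail. In the expanded product, the coordinates
outside `v` carry only the tail and can be integrated out. -/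
theorem smoothing_eq_sum_swap (H : IsAdmissible D ψ p) (k : Kind) (x : Fin d → D)
    {w : (u → ℝ) → ℝ} (hw : MemLp w p (weightedMeasure D ψ u)) :
    smoothing D ψ k u w x = ∑ v ∈ u.powerset, smoothing D ψ k.swap v
      (partialIntegral (densityMeasure D ψ) (fun t => k.sign * (tail D ψ t / ψ t)) v u w) x := by
  have := H.isProbabilityMeasure
  have := H.holderConjugate
  rw [H.memLp_iff] at hw
  have hI : ∀ v : Finset (Fin d), Integrable (fun t : u → ℝ => w t * ∏ j : u,
      (if (j : Fin d) ∈ v then kernel D ψ k.swap (x j) (t j) / ψ (t j)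
        else k.sign * (tail D ψ (t j) / ψ (t j)))) (Measure.pi fun _ => densityMeasure D ψ) := by
    intro v
    have := integrable_mul_pi_prod (p := p) H.conj_ne_zero
      (b := fun (j : u) s => if (j : Fin d) ∈ v then kernel D ψ k.swap (x j) s / ψ s
        else k.sign * (tail D ψ s / ψ s)) (fun j => by
          by_cases hj : (j : Fin d) ∈ v
          · simpa [hj] using H.memLp_kernel k.swap (x j)
          · simpa [hj] using H.memLp_sign_mul_tail k) hw
    exact this
  calc smoothing D ψ k u w x
      = ∫ t, ∑ v ∈ u.powerset, w t * ∏ j : u,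
          (if (j : Fin d) ∈ v then kernel D ψ k.swap (x j) (t j) / ψ (t j)
            else k.sign * (tail D ψ (t j) / ψ (t j)))
          ∂(Measure.pi fun _ => densityMeasure D ψ) := by
        rw [H.density.smoothing_eq]
        refine integral_congr_ae (.of_forall fun t => ?_)
        simp only [kernel_eq_swap_add D ψ k, add_div, mul_div_assoc]
        rw [prod_add_coe_sort, Finset.mul_sum]
    _ = _ := by
        rw [integral_finsetSum _ fun v _ => hI v]
        refine Finset.sum_congr rfl fun v hv => ?_
        rw [H.density.smoothing_eq]
        exact (integral_partialIntegral_mul (p := p) H.conj_ne_zero (Finset.mem_powerset.1 hv)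
          (H.memLp_sign_mul_tail k) (b := fun j s => kernel D ψ k.swap (x j) s / ψ s)
          (fun j => H.memLp_kernel k.swap (x j)) hw).symm

/-- Interchanging the sums over `u` and `v ⊆ u` collects the components. The hypothesis on `γ` is
what makes the new components vanish where `γ v = 0`: every contributing `u ⊇ v` then has weight
zero too. -/
theorem isDecomposition_transform (H : IsAdmissible D ψ p)
    (hγ : ∀ u v : Finset (Fin d), v ⊆ u → γ v = 0 → γ u = 0)
    (hg : IsDecomposition D ψ p k γ f g) :
    IsDecomposition D ψ p k.swap γ f (transform D ψ k g) where
  memLp v := memLp_finsetSum' _ fun u hu =>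
    H.memLp_partialIntegral k (Finset.mem_filter.1 hu).2 (hg.memLp u)
  eq_zero v hv := by
    have : ∀ u, v ⊆ u → partialIntegral (densityMeasure D ψ)
        (fun t => k.sign * (tail D ψ t / ψ t)) v u (g u) =ᵐ[weightedMeasure D ψ v] 0 :=
      fun u hvu => H.partialIntegral_ae_eq_zero k hvu (hg.memLp u) (hg.eq_zero u (hγ u v hvu hv))
    filter_upwards [ae_all_iff.2 fun u => ae_all_iff.2 fun hvu => this u hvu] with t ht
    simp only [transform, Finset.sum_apply]
    exact Finset.sum_eq_zero fun u hu => ht u (Finset.mem_filter.1 hu).2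
  sum_eq x := by
    rw [hg.sum_eq]
    simp only [transform]
    simp_rw [H.smoothing_eq_sum_swap k x (hg.memLp _)]
    rw [Finset.sum_comm' (t' := Finset.univ) (s' := fun v => {u | v ⊆ u}) (by simp)]
    refine Finset.sum_congr rfl fun v _ => ?_
    rw [H.smoothing_sum]
    exact fun u hu => H.memLp_partialIntegral k (Finset.mem_filter.1 hu).2 (hg.memLp u)

theorem partialIntegral_self (H : IsAdmissible D ψ p) (a : ℝ → ℝ) (w : (u → ℝ) → ℝ) :
    partialIntegral (densityMeasure D ψ) a u u w = w := by
  have := H.isProbabilityMeasure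
  ext t
  have : ∀ s : u → ℝ, merge u u (t, s) = t := fun s => by
    ext j
    simp [merge]
  simp [partialIntegral, this]

/-- Setting the coordinates outside `u` to `0` kills every term whose set is not contained in `u`.
Proper subsets vanish by induction, leaving only the term of `u`. -/
theorem anchored_ae_eq_zero (H : IsAdmissible D ψ p)
    (hg : IsDecomposition D ψ p .anchored γ 0 g) (u : Finset (Fin d)) :
    g u =ᵐ[weightedMeasure D ψ u] 0 := by
  induction u using Finset.strongInduction with
  | H u ih =>
    rw [H.density.weightedMeasure_eq_pi]
    refine H.kernelCondition.ae_eq_zero_of_integral_anchored_eq_zero H.interval H.density H.one_le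
      (H.memLp_iff.1 (hg.memLp u)) fun x hx => ?_
    let y : Fin d → D := fun i =>
      if hi : i ∈ u then ⟨x ⟨i, hi⟩, hx _⟩ else ⟨0, H.interval.isLeast_zero.1⟩
    have hy := hg.sum_eq y
    rw [Finset.sum_eq_single u] at hy
    · rw [H.density.smoothing_eq] at hy
      simpa [y] using hy.symm
    · intro v _ hvu
      by_cases hsub : v ⊆ u
      · rw [H.smoothing_congr _ _ (ih v (hsub.ssubset_of_ne hvu))]
        simp [smoothing]
      · obtain ⟨j, hjv, hju⟩ := Finset.not_subset.1 hsub
        have : ∀ t : v → ℝ, ∏ i : v, kernel D ψ .anchored (y i) (t i) = 0 := fun t =>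
          Finset.prod_eq_zero (Finset.mem_univ ⟨j, hjv⟩) (by simp [y, hju, kernel])
        simp only [smoothing, this, mul_zero, integral_zero]
    · simp

/-- For the ANOVA kind, the transform to anchored components is triangular for inclusion, with
identity diagonal. It is inverted by induction from large sets down to small ones. -/
theorem ae_eq_zero (H : IsAdmissible D ψ p)
    (hγ : ∀ u v : Finset (Fin d), v ⊆ u → γ v = 0 → γ u = 0)
    (hg : IsDecomposition D ψ p k γ 0 g) (u : Finset (Fin d)) :
    g u =ᵐ[weightedMeasure D ψ u] 0 := by
  cases k with
  | anchored => exact H.anchored_ae_eq_zero hg u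
  | anova =>
    have hT := H.anchored_ae_eq_zero (H.isDecomposition_transform hγ hg)
    induction u using WellFoundedGT.induction with
    | ind v ih =>
      have hv : ∀ u, v ⊂ u → partialIntegral (densityMeasure D ψ)
          (fun t => Kind.anova.sign * (tail D ψ t / ψ t)) v u (g u) =ᵐ[weightedMeasure D ψ v] 0 :=
        fun u hvu => H.partialIntegral_ae_eq_zero _ hvu.subset (hg.memLp u) (ih u hvu)
      filter_upwards [hT v, ae_all_iff.2 fun u => ae_all_iff.2 fun hvu => hv u hvu] with t h1 h2
      simp only [transform, Finset.sum_apply] at h1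
      rw [Finset.sum_eq_single v, H.partialIntegral_self] at h1
      · exact h1
      · exact fun u hu huv => h2 u ((Finset.mem_filter.1 hu).2.ssubset_of_ne huv.symm)
      · simp

theorem ae_eq (H : IsAdmissible D ψ p)
    (hγ : ∀ u v : Finset (Fin d), v ⊆ u → γ v = 0 → γ u = 0)
    (hg : IsDecomposition D ψ p k γ f g) (hh : IsDecomposition D ψ p k γ f h)
    (u : Finset (Fin d)) : g u =ᵐ[weightedMeasure D ψ u] h u := by
  have hdiff : IsDecomposition D ψ p k γ 0 fun u => g u - h u :=
    { memLp := fun u => (hg.memLp u).sub (hh.memLp u)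
      eq_zero := fun u hu => by
        filter_upwards [hg.eq_zero u hu, hh.eq_zero u hu] with t h1 h2
        simp [h1, h2]
      sum_eq := fun x => by
        simp_rw [H.smoothing_sub k x (hg.memLp _) (hh.memLp _)]
        rw [Finset.sum_sub_distrib, ← hg.sum_eq, ← hh.sum_eq]
        simp }
  filter_upwards [H.ae_eq_zero hγ hdiff u] with t ht
  exact sub_eq_zero.1 ht

end IsAdmissible

end Transform

/-! ### Symmetry of the embedding norms and the `ℓ_q` estimate. -/

section Norms

variable {D : Set ℝ} {ψ : ℝ → ℝ} {p q : ℝ≥0∞} {d : ℕ} {γ : Finset (Fin d) → ℝ≥0} {k k' : Kind}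
  {f : (Fin d → D) → ℝ} {g : (u : Finset (Fin d)) → (u → ℝ) → ℝ}

/-- Multiply the components of odd order by `-1`. -/
def alternate (g : (u : Finset (Fin d)) → (u → ℝ) → ℝ) (u : Finset (Fin d)) : (u → ℝ) → ℝ :=
  fun t => (-1) ^ u.card * g u t

theorem eLpNorm_alternate (u : Finset (Fin d)) (μ : Measure (u → ℝ)) :
    eLpNorm (alternate g u) p μ = eLpNorm (g u) p μ := by
  have := eLpNorm_const_smul ((-1 : ℝ) ^ u.card) (g u) p μ
  simp only [enorm_pow, enorm_neg, enorm_one, one_pow, one_mul] at this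
  exact this

/-- Swapping the kind changes the sign of the tail, which contributes `(-1)^{|u \ v|}`; this turns
`(-1)^{|u|}` into `(-1)^{|v|}`. -/
theorem transform_alternate (k : Kind) :
    transform D ψ k.swap (alternate g) = alternate (transform D ψ k g) := by
  ext v t
  simp only [transform, alternate, Finset.sum_apply, Finset.mul_sum]
  refine Finset.sum_congr rfl fun u hu => ?_
  have hvu := (Finset.mem_filter.1 hu).2
  simp only [partialIntegral]
  rw [← integral_const_mul]
  refine integral_congr_ae (.of_forall fun s => ?_)
  have : ∏ j : u, (if (j : Fin d) ∈ v then 1 else k.swap.sign * (tail D ψ (s j) / ψ (s j))) =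
      (-1) ^ (u \ v).card *
        ∏ j : u, (if (j : Fin d) ∈ v then 1 else k.sign * (tail D ψ (s j) / ψ (s j))) := by
    rw [← Finset.prod_const, Finset.sdiff_eq_filter, Finset.prod_filter,
      ← Finset.prod_coe_sort u, ← Finset.prod_mul_distrib]
    refine Finset.prod_congr rfl fun j _ => ?_
    by_cases hj : (j : Fin d) ∈ v <;> simp [hj, k.sign_swap]
  have hc : (-1 : ℝ) ^ u.card = (-1) ^ (u \ v).card * (-1) ^ v.card := by
    rw [← pow_add, Finset.card_sdiff_add_card_eq_card hvu]
  simp only [alternate, this, hc]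
  have h1 : ((-1 : ℝ) ^ (u \ v).card) * (-1) ^ (u \ v).card = 1 := by
    rw [← mul_pow]
    simp
  linear_combination ((-1) ^ v.card * g u (merge v u (t, s)) *
    ∏ j : u, (if (j : Fin d) ∈ v then 1 else k.sign * (tail D ψ (s j) / ψ (s j)))) * h1

theorem IsDecomposition.alternate (hg : IsDecomposition D ψ p k γ f g) (k' : Kind) :
    IsDecomposition D ψ p k' γ (fun x => ∑ u, smoothing D ψ k' u (alternate g u) x)
      (alternate g) where
  memLp u := (hg.memLp u).const_mul _
  eq_zero u hu := by
    filter_upwards [hg.eq_zero u hu] with t ht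
    simp [AnchoredAnova.alternate, ht]
  sum_eq _ := rfl

theorem spaceNorm_le_lqNorm (hg : IsDecomposition D ψ p k γ f g) :
    spaceNorm D ψ p q k γ f ≤ lqNorm q γ fun u => eLpNorm (g u) p (weightedMeasure D ψ u) / γ u :=
  iInf₂_le g hg

namespace IsAdmissible

theorem spaceNorm_eq_lqNorm (H : IsAdmissible D ψ p)
    (hγ : ∀ u v : Finset (Fin d), v ⊆ u → γ v = 0 → γ u = 0)
    (hg : IsDecomposition D ψ p k γ f g) :
    spaceNorm D ψ p q k γ f = lqNorm q γ fun u => eLpNorm (g u) p (weightedMeasure D ψ u) / γ u :=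
  le_antisymm (spaceNorm_le_lqNorm hg) <| le_iInf₂ fun h hh => by
    simp only [eLpNorm_congr_ae (H.ae_eq hγ hg hh _), le_refl]

theorem space_subset_swap (H : IsAdmissible D ψ p)
    (hγ : ∀ u v : Finset (Fin d), v ⊆ u → γ v = 0 → γ u = 0) (k : Kind) :
    space D ψ p k γ ⊆ space D ψ p k.swap γ := by
  rintro f ⟨g, hg⟩
  exact ⟨_, H.isDecomposition_transform hγ hg⟩

/-- A test function of kind `k` is matched with the function of the other kind having the alternated
components. Both its norms are the same with the kinds exchanged. -/
theorem embeddingNorm_le_swap (H : IsAdmissible D ψ p)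
    (hγ : ∀ u v : Finset (Fin d), v ⊆ u → γ v = 0 → γ u = 0) (k : Kind) :
    embeddingNorm D ψ p q k k.swap γ ≤ embeddingNorm D ψ p q k.swap k γ := by
  refine iSup₂_le fun f hf => ?_
  obtain ⟨⟨g, hg⟩, hf1⟩ := hf
  have ha := hg.alternate k.swap
  set f' : (Fin d → D) → ℝ := fun x => ∑ u, smoothing D ψ k.swap u (alternate g u) x
  have hf' : spaceNorm D ψ p q k.swap γ f' ≤ 1 := by
    rw [H.spaceNorm_eq_lqNorm hγ hg] at hf1
    rw [H.spaceNorm_eq_lqNorm hγ ha]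
    simpa only [eLpNorm_alternate] using hf1
  refine le_trans ?_ (le_iSup₂ (f := fun f (_ : f ∈ {f ∈ space D ψ p k.swap γ |
    spaceNorm D ψ p q k.swap γ f ≤ 1}) => spaceNorm D ψ p q k γ f) f' ⟨⟨_, ha⟩, hf'⟩)
  have h1 := H.isDecomposition_transform hγ hg
  have h2 := H.isDecomposition_transform hγ ha
  rw [transform_alternate, Kind.swap_swap] at h2
  rw [H.spaceNorm_eq_lqNorm hγ h1, H.spaceNorm_eq_lqNorm hγ h2]
  simp only [eLpNorm_alternate, le_refl]

theorem embeddingNorm_swap (H : IsAdmissible D ψ p)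
    (hγ : ∀ u v : Finset (Fin d), v ⊆ u → γ v = 0 → γ u = 0) (k : Kind) :
    embeddingNorm D ψ p q k k.swap γ = embeddingNorm D ψ p q k.swap k γ :=
  le_antisymm (H.embeddingNorm_le_swap hγ k) <| by
    simpa using H.embeddingNorm_le_swap (q := q) hγ k.swap

theorem eLpNorm_transform_le (H : IsAdmissible D ψ p) (hg : IsDecomposition D ψ p k γ f g)
    (v : Finset (Fin d)) :
    eLpNorm (transform D ψ k g v) p (weightedMeasure D ψ v) ≤
      ∑ u with 0 < γ u ∧ v ⊆ u,
        tailNorm D ψ p ^ (u \ v).card * eLpNorm (g u) p (weightedMeasure D ψ u) := by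
  calc eLpNorm (transform D ψ k g v) p (weightedMeasure D ψ v)
      ≤ ∑ u with v ⊆ u, eLpNorm (partialIntegral (densityMeasure D ψ)
          (fun t => k.sign * (tail D ψ t / ψ t)) v u (g u)) p (weightedMeasure D ψ v) :=
        eLpNorm_sum_le (fun u hu => (H.memLp_partialIntegral k (Finset.mem_filter.1 hu).2
          (hg.memLp u)).1) H.one_le
    _ ≤ ∑ u with v ⊆ u,
          tailNorm D ψ p ^ (u \ v).card * eLpNorm (g u) p (weightedMeasure D ψ u) :=
        Finset.sum_le_sum fun u hu =>
          H.eLpNorm_partialIntegral_le k (Finset.mem_filter.1 hu).2 (hg.memLp u)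
    _ = _ := by
        symm
        refine Finset.sum_subset (fun u hu => by simp_all) fun u hu hu' => ?_
        have hγu : γ u = 0 := by simp_all
        rw [(eLpNorm_eq_zero_iff (hg.memLp u).1 H.ne_zero).2 (hg.eq_zero u hγu), mul_zero]

end IsAdmissible

/-- The power mean inequality costs `card^{q-1}` inside the `q`-th power. After interchanging sums
each `n u` is counted once per subset of `u`, at most `2^r` times. For `q = ∞` counting terms
suffices, and the factor `2^r` is only slack. -/
theorem lqNorm_le_of_le_mul_sum {r : ℕ} (hq : 1 ≤ q) (hγ : ∀ u, 0 < γ u → u.card ≤ r) {K : ℝ≥0∞}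
    {N n : Finset (Fin d) → ℝ≥0∞}
    (hN : ∀ v, 0 < γ v → N v ≤ K * ∑ u with 0 < γ u ∧ v ⊆ u, n u) :
    lqNorm q γ N ≤
      K * 2 ^ r * (Finset.card {u | 0 < γ u} : ℝ≥0∞) ^ (1 - (q⁻¹).toReal) * lqNorm q γ n := by
  have h2 : (1 : ℝ≥0∞) ≤ 2 ^ r := one_le_pow₀ one_le_two
  by_cases hqt : q = ∞
  · simp only [lqNorm, hqt, if_true, ENNReal.inv_top, ENNReal.toReal_zero, sub_zero,
      ENNReal.rpow_one]
    refine iSup₂_le fun v hv => (hN v hv).trans ?_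
    set S := ⨆ u ∈ {u | 0 < γ u}, n u with hS
    calc K * ∑ u with 0 < γ u ∧ v ⊆ u, n u
        ≤ K * ∑ u with 0 < γ u ∧ v ⊆ u, S := by
          gcongr with u hu
          exact le_iSup₂ (f := fun u (_ : u ∈ {u | 0 < γ u}) => n u) u
            (Finset.mem_filter.1 hu).2.1
      _ ≤ K * 1 * (Finset.card {u | 0 < γ u} : ℝ≥0∞) * S := by
          rw [Finset.sum_const, nsmul_eq_mul, mul_one, mul_assoc]
          gcongr
          exact And.left
      _ ≤ _ := by gcongr
  · have hQ : 1 ≤ q.toReal := by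
      simpa using ENNReal.toReal_mono hqt hq
    have hQ0 : 0 < q.toReal := by linarith
    simp only [lqNorm, hqt, if_false]
    set A : Finset (Finset (Fin d)) := {u | 0 < γ u} with hA
    have key : ∑ v with 0 < γ v, N v ^ q.toReal ≤
        K ^ q.toReal * ((A.card : ℝ≥0∞) ^ (q.toReal - 1) *
          (2 ^ r * ∑ u with 0 < γ u, n u ^ q.toReal)) := by
      calc ∑ v with 0 < γ v, N v ^ q.toReal
          ≤ ∑ v with 0 < γ v, K ^ q.toReal * ((A.card : ℝ≥0∞) ^ (q.toReal - 1) *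
              ∑ u with 0 < γ u ∧ v ⊆ u, n u ^ q.toReal) := by
            refine Finset.sum_le_sum fun v hv => ?_
            refine (ENNReal.rpow_le_rpow (hN v (Finset.mem_filter.1 hv).2) hQ0.le).trans ?_
            rw [ENNReal.mul_rpow_of_nonneg _ _ hQ0.le]
            gcongr
            refine (ENNReal.rpow_sum_le_const_mul_sum_rpow _ _ hQ).trans ?_
            have : 0 ≤ q.toReal - 1 := by linarith
            gcongr
            exact fun u hu => by simp_all
        _ = K ^ q.toReal * ((A.card : ℝ≥0∞) ^ (q.toReal - 1) *
              ∑ v with 0 < γ v, ∑ u with 0 < γ u ∧ v ⊆ u, n u ^ q.toReal) := by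
            rw [← Finset.mul_sum, ← Finset.mul_sum]
        _ ≤ _ := by
            gcongr
            rw [Finset.sum_comm' (t' := A) (s' := fun u => {v | 0 < γ v ∧ v ⊆ u})
              (by intro v u; simp [hA]; tauto), Finset.mul_sum]
            refine Finset.sum_le_sum fun u hu => ?_
            rw [Finset.sum_const, nsmul_eq_mul]
            gcongr
            have h1 : Finset.card {v | 0 < γ v ∧ v ⊆ u} ≤ 2 ^ u.card := by
              rw [← Finset.card_powerset]
              exact Finset.card_le_card fun v hv => by simp_all
            have h3 : 2 ^ u.card ≤ 2 ^ r :=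
              Nat.pow_le_pow_right two_pos (hγ u (Finset.mem_filter.1 hu).2)
            exact_mod_cast h1.trans h3
    refine (ENNReal.rpow_le_rpow key (by positivity)).trans ?_
    have hQi : 0 ≤ 1 / q.toReal := by positivity
    rw [ENNReal.mul_rpow_of_nonneg _ _ hQi, ENNReal.mul_rpow_of_nonneg _ _ hQi,
      ENNReal.mul_rpow_of_nonneg _ _ hQi, ← ENNReal.rpow_mul, ← ENNReal.rpow_mul,
      mul_one_div_cancel hQ0.ne', ENNReal.rpow_one]
    have he : (q.toReal - 1) * (1 / q.toReal) = 1 - (q⁻¹).toReal := by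
      rw [ENNReal.toReal_inv]
      field_simp
    rw [he, ← mul_assoc, ← mul_assoc, mul_right_comm K]
    gcongr
    calc ((2 : ℝ≥0∞) ^ r) ^ (1 / q.toReal) ≤ ((2 : ℝ≥0∞) ^ r) ^ (1 : ℝ) :=
          ENNReal.rpow_le_rpow_of_exponent_le h2 ((div_le_one hQ0).2 hQ)
      _ = 2 ^ r := ENNReal.rpow_one _

end Norms

/-! ### Two-sided bounds for finite order weights. -/

section FiniteOrder

variable {D : Set ℝ} {ψ : ℝ → ℝ} {p q : ℝ≥0∞} {d r : ℕ} {ω : ℝ≥0}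

theorem finiteOrderWeights_pos_iff (hω : 0 < ω) {u : Finset (Fin d)} :
    0 < finiteOrderWeights r ω d u ↔ u.card ≤ r := by
  by_cases h : u.card ≤ r <;> simp [finiteOrderWeights, h, hω]

theorem finiteOrderWeights_eq_zero_of_subset (hω : 0 < ω) (u v : Finset (Fin d)) (hvu : v ⊆ u)
    (hv : finiteOrderWeights r ω d v = 0) : finiteOrderWeights r ω d u = 0 := by
  rw [← not_ne_iff, ← pos_iff_ne_zero, finiteOrderWeights_pos_iff hω] at hv ⊢
  exact fun h => hv ((Finset.card_le_card hvu).trans h)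

theorem card_finiteOrderWeights_pos_le (hω : 0 < ω) (hd : 1 ≤ d) :
    Finset.card {u | 0 < finiteOrderWeights r ω d u} ≤ (r + 1) * d ^ r := by
  have hsub : ({u | 0 < finiteOrderWeights r ω d u} : Finset (Finset (Fin d))) ⊆
      (Finset.range (r + 1)).biUnion fun i => Finset.powersetCard i Finset.univ := by
    intro u hu
    simpa [finiteOrderWeights_pos_iff hω, Nat.lt_succ_iff] using hu
  calc _ ≤ _ := Finset.card_le_card hsub
    _ ≤ ∑ i ∈ Finset.range (r + 1), (Finset.powersetCard i (Finset.univ : Finset (Fin d))).card :=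
      Finset.card_biUnion_le
    _ ≤ ∑ i ∈ Finset.range (r + 1), d ^ r := Finset.sum_le_sum fun i hi => by
      rw [Finset.card_powersetCard, Finset.card_univ, Fintype.card_fin]
      exact (Nat.choose_le_pow _ _).trans
        (Nat.pow_le_pow_right hd (Nat.lt_succ_iff.1 (Finset.mem_range.1 hi)))
    _ = _ := by simp

namespace IsAdmissible

/-- The ratio `γ u / γ v = ω^{|u \ v|}` turns the Hölder cost into `(κω)^{|u \ v|}`. Adding `1` to
the base makes this monotone in the exponent, so `(1 + κω)^r` dominates it uniformly. -/
theorem embeddingNorm_finiteOrderWeights_le (H : IsAdmissible D ψ p) (hq : 1 ≤ q) (hω : 0 < ω)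
    (k : Kind) :
    embeddingNorm D ψ p q k k.swap (finiteOrderWeights r ω d) ≤
      (1 + tailNorm D ψ p * ω) ^ r * 2 ^ r *
        (Finset.card {u | 0 < finiteOrderWeights r ω d u} : ℝ≥0∞) ^ (1 - (q⁻¹).toReal) := by
  set γ := finiteOrderWeights r ω d with hγdef
  have hγ := finiteOrderWeights_eq_zero_of_subset (d := d) (r := r) hω
  refine iSup₂_le fun f hf => ?_
  obtain ⟨⟨g, hg⟩, hf1⟩ := hf
  rw [H.spaceNorm_eq_lqNorm hγ hg] at hf1
  refine (spaceNorm_le_lqNorm (H.isDecomposition_transform hγ hg)).trans ?_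
  refine (lqNorm_le_of_le_mul_sum (r := r) (K := (1 + tailNorm D ψ p * ω) ^ r)
    (n := fun u => eLpNorm (g u) p (weightedMeasure D ψ u) / γ u) hq
    (fun u hu => (finiteOrderWeights_pos_iff hω).1 hu) fun v hv => ?_).trans
      (mul_le_of_le_one_right' hf1)
  refine ENNReal.div_le_of_le_mul ((H.eLpNorm_transform_le hg v).trans ?_)
  rw [Finset.mul_sum, Finset.sum_mul]
  refine Finset.sum_le_sum fun u hu => ?_
  obtain ⟨hu, hvu⟩ := (Finset.mem_filter.1 hu).2
  have hur := (finiteOrderWeights_pos_iff hω).1 hu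
  have hvr := (finiteOrderWeights_pos_iff hω).1 hv
  have h1 : (γ u : ℝ≥0∞) = (ω : ℝ≥0∞) ^ (u \ v).card * γ v := by
    simp only [hγdef, finiteOrderWeights, hur, hvr, if_true]
    push_cast
    rw [← pow_add, Finset.card_sdiff_add_card_eq_card hvu]
  have h2 : eLpNorm (g u) p (weightedMeasure D ψ u) =
      eLpNorm (g u) p (weightedMeasure D ψ u) / γ u * γ u :=
    (ENNReal.div_mul_cancel (by simpa using hu.ne') ENNReal.coe_ne_top).symm
  calc tailNorm D ψ p ^ (u \ v).card * eLpNorm (g u) p (weightedMeasure D ψ u)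
      = (tailNorm D ψ p * ω) ^ (u \ v).card *
          (eLpNorm (g u) p (weightedMeasure D ψ u) / γ u) * γ v := by
        rw [h2]
        nth_rw 2 [h1]
        rw [mul_pow, ← h2]
        ring
    _ ≤ _ := by
        refine mul_le_mul_left (mul_le_mul_left ?_ _) _
        calc (tailNorm D ψ p * ω) ^ (u \ v).card
            ≤ (1 + tailNorm D ψ p * ω) ^ (u \ v).card := by
              gcongr
              exact le_add_self
          _ ≤ _ := pow_le_pow_right₀ (by simp)
              ((Finset.card_le_card Finset.sdiff_subset).trans hur)

/-- At the anchor every term with `u ≠ ∅` vanishes, so `f(0)` is the component of `∅`, and this is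
one entry of the `ℓ_q` norm. Outside the space the right side is `∞`. -/
theorem enorm_apply_zero_le (H : IsAdmissible D ψ p) {γ : Finset (Fin d) → ℝ≥0} (hγ : γ ∅ = 1)
    (hq : 1 ≤ q) (f : (Fin d → D) → ℝ) :
    ‖f fun _ => ⟨0, H.interval.isLeast_zero.1⟩‖ₑ ≤ spaceNorm D ψ p q .anchored γ f := by
  have := H.isProbabilityMeasure
  refine le_iInf₂ fun h hh => ?_
  calc ‖f fun _ => ⟨0, H.interval.isLeast_zero.1⟩‖ₑ
      = ‖∫ t, h ∅ t ∂(Measure.pi fun _ => densityMeasure D ψ)‖ₑ := by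
        rw [hh.sum_eq, Finset.sum_eq_single ∅]
        · rw [H.density.smoothing_eq]
          simp
        · intro u _ hu
          obtain ⟨j, hj⟩ := Finset.nonempty_iff_ne_empty.2 hu
          have : ∀ t : u → ℝ, ∏ i : u, kernel D ψ .anchored 0 (t i) = 0 := fun t =>
            Finset.prod_eq_zero (Finset.mem_univ ⟨j, hj⟩) (by simp [kernel])
          simp only [smoothing, this, mul_zero, integral_zero]
        · simp
    _ ≤ eLpNorm (h ∅) 1 (Measure.pi fun _ => densityMeasure D ψ) := by
        rw [eLpNorm_one_eq_lintegral_enorm]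
        exact enorm_integral_le_lintegral_enorm _
    _ ≤ eLpNorm (h ∅) p (Measure.pi fun _ => densityMeasure D ψ) :=
        eLpNorm_le_eLpNorm_of_exponent_le H.one_le (H.memLp_iff.1 (hh.memLp ∅)).1
    _ ≤ _ := by
        rw [← H.density.weightedMeasure_eq_pi]
        have h0 : eLpNorm (h ∅) p (weightedMeasure D ψ (∅ : Finset (Fin d))) =
          eLpNorm (h ∅) p (weightedMeasure D ψ (∅ : Finset (Fin d))) / γ ∅ := by simp [hγ]
        rw [h0]
        have hmem : 0 < γ ∅ := by simp [hγ]
        by_cases hqt : q = ∞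
        · simp only [lqNorm, hqt, if_true]
          exact le_iSup₂ (f := fun u (_ : u ∈ {u | 0 < γ u}) =>
            eLpNorm (h u) p (weightedMeasure D ψ u) / γ u) ∅ hmem
        · have hQ0 : 0 < q.toReal := ENNReal.toReal_pos (zero_lt_one.trans_le hq).ne' hqt
          simp only [lqNorm, hqt, if_false]
          rw [one_div, ENNReal.le_rpow_inv_iff hQ0]
          exact Finset.single_le_sum (f := fun u =>
            (eLpNorm (h u) p (weightedMeasure D ψ u) / γ u) ^ q.toReal)
            (fun _ _ => bot_le) (Finset.mem_filter.2 ⟨Finset.mem_univ _, hmem⟩)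

/-- The sum of the constant components `c` over all index sets of size `r`. -/
theorem isDecomposition_const (H : IsAdmissible D ψ p) (hω : 0 < ω) (c : ℝ) :
    IsDecomposition D ψ p .anova (finiteOrderWeights r ω d)
      (fun x => ∑ u, smoothing D ψ .anova u (fun _ => if u.card = r then c else 0) x)
      (fun u _ => if u.card = r then c else 0) where
  memLp u := by
    have := H.isProbabilityMeasure
    rw [H.memLp_iff]
    exact memLp_const _
  eq_zero u hu := by
    have : ¬ u.card ≤ r := by
      rw [← finiteOrderWeights_pos_iff hω, hu]
      exact lt_irrefl 0
    refine .of_forall fun t => ?_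
    simp only [Pi.zero_apply, ite_eq_right_iff]
    exact fun h => absurd h.le this
  sum_eq _ := rfl

/-- At `x = 0` the ANOVA kernel is `-ψ̄`, so each integral factorises over its `r` coordinates. -/
theorem sum_smoothing_const_zero (H : IsAdmissible D ψ p) (c : ℝ) :
    ∑ u : Finset (Fin d), smoothing D ψ .anova u (fun _ => if u.card = r then c else 0)
        (fun _ => ⟨0, H.interval.isLeast_zero.1⟩) =
      d.choose r * (c * (-∫ t, tail D ψ t / ψ t ∂(densityMeasure D ψ)) ^ r) := by
  have := H.isProbabilityMeasure
  have h : ∀ u : Finset (Fin d), smoothing D ψ .anova u (fun _ => if u.card = r then c else 0)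
      (fun _ => ⟨0, H.interval.isLeast_zero.1⟩) = if u.card = r then
        c * (-∫ t, tail D ψ t / ψ t ∂(densityMeasure D ψ)) ^ r else 0 := by
    intro u
    rw [H.density.smoothing_eq]
    by_cases hu : u.card = r
    · simp only [hu, if_true, kernel, Set.Ico_self, Set.indicator_empty, zero_sub]
      rw [integral_const_mul, integral_fintype_prod_eq_prod (fun _ s => -tail D ψ s / ψ s)]
      simp [neg_div, integral_neg, hu]
    · simp [hu]
  simp only [h]
  rw [← Finset.sum_filter, Finset.sum_const, nsmul_eq_mul, Finset.univ_filter_card_eq]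
  simp

/-- Dividing by `γ u = ω^r` leaves `C(d,r)` equal entries `C(d,r)^{-1/q}`, whose `ℓ_q` norm is one.
-/
theorem lqNorm_const_le (H : IsAdmissible D ψ p) (hq : 1 ≤ q) (hω : 0 < ω) (hrd : r ≤ d) :
    lqNorm q (finiteOrderWeights r ω d) (fun u => eLpNorm
      (fun _ : u → ℝ => if u.card = r then
        (ω : ℝ) ^ r * (d.choose r : ℝ) ^ (-(q⁻¹).toReal) else 0) p (weightedMeasure D ψ u)
          / finiteOrderWeights r ω d u) ≤ 1 := by
  have := H.isProbabilityMeasure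
  have hC : 0 < (d.choose r : ℝ) := by exact_mod_cast Nat.choose_pos hrd
  have h : ∀ u : Finset (Fin d), eLpNorm
      (fun _ : u → ℝ => if u.card = r then
        (ω : ℝ) ^ r * (d.choose r : ℝ) ^ (-(q⁻¹).toReal) else 0) p (weightedMeasure D ψ u)
          / finiteOrderWeights r ω d u =
      if u.card = r then ENNReal.ofReal ((d.choose r : ℝ) ^ (-(q⁻¹).toReal)) else 0 := by
    intro u
    rw [H.density.weightedMeasure_eq_pi,
      eLpNorm_const _ H.ne_zero (IsProbabilityMeasure.ne_zero _)]
    by_cases hu : u.card = r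
    · have hω' : (ω : ℝ≥0∞) ^ r ≠ 0 := pow_ne_zero _ (by simpa using hω.ne')
      simp only [hu, if_true, finiteOrderWeights, le_refl, measure_univ, ENNReal.one_rpow, mul_one]
      rw [enorm_mul, mul_comm, ENNReal.coe_pow, Real.enorm_eq_ofReal (by positivity),
        enorm_pow, NNReal.enorm_eq, mul_div_assoc, ENNReal.div_self hω' (by finiteness), mul_one]
    · simp [hu]
  simp only [h]
  by_cases hqt : q = ∞
  · simp only [lqNorm, hqt, if_true]
    refine iSup₂_le fun u _ => ?_
    split_ifs <;> simp
  · have hQ0 : 0 < q.toReal := ENNReal.toReal_pos (zero_lt_one.trans_le hq).ne' hqt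
    simp only [lqNorm, hqt, if_false]
    rw [one_div, ENNReal.rpow_inv_le_iff hQ0, ENNReal.one_rpow]
    calc ∑ u with 0 < finiteOrderWeights r ω d u, (if u.card = r then
          ENNReal.ofReal ((d.choose r : ℝ) ^ (-(q⁻¹).toReal)) else 0) ^ q.toReal
        ≤ ∑ u : Finset (Fin d), (if u.card = r then
          ENNReal.ofReal ((d.choose r : ℝ) ^ (-(q⁻¹).toReal)) else 0) ^ q.toReal :=
          Finset.sum_le_sum_of_subset (Finset.filter_subset _ _)
      _ = ∑ u : Finset (Fin d), (if u.card = r then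
          ENNReal.ofReal ((d.choose r : ℝ)⁻¹) else 0) := by
          refine Finset.sum_congr rfl fun u _ => ?_
          split_ifs
          · rw [ENNReal.ofReal_rpow_of_nonneg (by positivity) hQ0.le, ← Real.rpow_mul hC.le,
              ENNReal.toReal_inv, neg_mul, inv_mul_cancel₀ hQ0.ne', Real.rpow_neg_one]
          · exact ENNReal.zero_rpow_of_pos hQ0
      _ ≤ 1 := by
          rw [← Finset.sum_filter, Finset.sum_const, nsmul_eq_mul,
            Finset.univ_filter_card_eq, Finset.card_powersetCard, Finset.card_univ,
            Fintype.card_fin, ENNReal.ofReal_inv_of_pos hC, ENNReal.ofReal_natCast]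
          exact ENNReal.mul_inv_le_one _

/-- The `C(d,r)` contributions at the anchor add without cancellation, whereas the normalisation
loses only `C(d,r)^{1/q}`. -/
theorem le_iotaNorm (H : IsAdmissible D ψ p) (hq : 1 ≤ q) (hω : 0 < ω) (hrd : r ≤ d) :
    ENNReal.ofReal ((ω * ∫ t, tail D ψ t / ψ t ∂(densityMeasure D ψ)) ^ r *
        (d.choose r : ℝ) ^ (1 - (q⁻¹).toReal)) ≤
      iotaNorm D ψ p q (finiteOrderWeights r ω) d := by
  have hC : 0 < (d.choose r : ℝ) := by exact_mod_cast Nat.choose_pos hrd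
  have hpos := H.kernelCondition.integral_tail_pos H.interval H.density H.one_le
  set c : ℝ := (ω : ℝ) ^ r * (d.choose r : ℝ) ^ (-(q⁻¹).toReal) with hc
  have hdec := H.isDecomposition_const (d := d) (r := r) hω c
  set f : (Fin d → D) → ℝ :=
    fun x => ∑ u, smoothing D ψ .anova u (fun _ => if u.card = r then c else 0) x with hf
  have hf0 : ‖f fun _ => ⟨0, H.interval.isLeast_zero.1⟩‖ₑ = ENNReal.ofReal
      ((ω * ∫ t, tail D ψ t / ψ t ∂(densityMeasure D ψ)) ^ r *
        (d.choose r : ℝ) ^ (1 - (q⁻¹).toReal)) := by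
    rw [hf]
    beta_reduce
    rw [H.sum_smoothing_const_zero, Real.enorm_eq_ofReal_abs, abs_mul, abs_mul, abs_pow, abs_neg,
      abs_of_pos hpos, abs_of_pos hC, abs_of_nonneg (by positivity), hc, sub_eq_add_neg,
      Real.rpow_add hC, Real.rpow_one, mul_pow]
    congr 1
    ring
  rw [← hf0]
  refine (H.enorm_apply_zero_le (γ := finiteOrderWeights r ω d) (by simp [finiteOrderWeights])
    hq f).trans ?_
  exact le_iSup₂ (f := fun f (_ : f ∈ {f ∈ space D ψ p .anova (finiteOrderWeights r ω d) |
    spaceNorm D ψ p q .anova (finiteOrderWeights r ω d) f ≤ 1}) =>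
      spaceNorm D ψ p q .anchored (finiteOrderWeights r ω d) f) f
    ⟨⟨_, hdec⟩, (spaceNorm_le_lqNorm hdec).trans (H.lqNorm_const_le hq hω hrd)⟩

end IsAdmissible

end FiniteOrder

/-! ### Growth in `d` and the exponent of polynomial equivalence. -/

section Asymptotics

theorem isPolynomialExponent_of_isTheta {N : ℕ → ℝ≥0∞} {e : ℝ} (he : 0 ≤ e)
    (hfin : ∀ d, 1 ≤ d → N d < ∞)
    (hN : (fun d : ℕ => (N d).toReal) =Θ[atTop] fun d : ℕ => (d : ℝ) ^ e) :
    IsPolynomialExponent N e := by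
  constructor
  · rintro τ ⟨-, -, hτ⟩
    by_contra! hlt
    have h1 : (fun d : ℕ => (d : ℝ) ^ e) =O[atTop] fun d : ℕ => (d : ℝ) ^ τ :=
      hN.2.trans hτ
    have h2 : (fun x : ℝ => x ^ τ) =o[atTop] fun x : ℝ => x ^ e := by
      refine Asymptotics.isLittleO_of_tendsto' ?_
        ((tendsto_rpow_neg_atTop (sub_pos.2 hlt)).congr' ?_)
      · filter_upwards [eventually_gt_atTop 0] with x hx h0
        exact absurd h0 (Real.rpow_pos_of_pos hx e).ne'
      · filter_upwards [eventually_gt_atTop 0] with x hx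
        rw [← Real.rpow_sub hx, neg_sub]
    have h3 := h1.trans_isLittleO (h2.comp_tendsto tendsto_natCast_atTop_atTop)
    refine Asymptotics.isLittleO_irrefl ?_ h3
    refine (eventually_gt_atTop 0).frequently.mono fun d hd => ?_
    have : 0 < (d : ℝ) := by exact_mod_cast hd
    exact (Real.rpow_pos_of_pos this e).ne'
  · intro b hb
    -- The exponent `e` may be `0`, which is not admissible, so `e + ε` is used for every `ε > 0`.
    refine le_of_forall_pos_le_add fun ε hε => hb ⟨by linarith, hfin, hN.1.trans ?_⟩
    refine Asymptotics.IsBigO.of_bound' ((eventually_ge_atTop 1).mono fun d hd => ?_)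
    have h1 : (1 : ℝ) ≤ d := by exact_mod_cast hd
    rw [Real.norm_of_nonneg (by positivity), Real.norm_of_nonneg (by positivity)]
    exact Real.rpow_le_rpow_of_exponent_le h1 (by linarith)

theorem polynomiallyEquivalent_of_isTheta {N : ℕ → ℝ≥0∞} {e : ℝ} (he : 0 ≤ e)
    (hfin : ∀ d, 1 ≤ d → N d < ∞)
    (hN : (fun d : ℕ => (N d).toReal) =Θ[atTop] fun d : ℕ => (d : ℝ) ^ e) :
    PolynomiallyEquivalent N := by
  refine ⟨e + 1, by linarith, hfin, hN.1.trans ?_⟩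
  refine Asymptotics.IsBigO.of_bound' ((eventually_ge_atTop 1).mono fun d hd => ?_)
  have h1 : (1 : ℝ) ≤ d := by exact_mod_cast hd
  rw [Real.norm_of_nonneg (by positivity), Real.norm_of_nonneg (by positivity)]
  exact Real.rpow_le_rpow_of_exponent_le h1 (by linarith)

namespace IsAdmissible

variable {D : Set ℝ} {ψ : ℝ → ℝ} {p q : ℝ≥0∞} {r : ℕ} {ω : ℝ≥0}

/-- The constant serves all `d ≥ 1` at once, not just large `d`; this is what uniform equivalence
needs. -/
theorem exists_iotaNorm_le (H : IsAdmissible D ψ p) (hq : 1 ≤ q) (r : ℕ) (hω : 0 < ω) :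
    ∃ B : ℝ≥0, ∀ d : ℕ, 1 ≤ d → iotaNorm D ψ p q (finiteOrderWeights r ω) d ≤
      B * (d : ℝ≥0∞) ^ ((r : ℝ) * (1 - (q⁻¹).toReal)) := by
  have hs : 0 ≤ 1 - (q⁻¹).toReal := by
    have := ENNReal.toReal_mono ENNReal.one_ne_top (ENNReal.inv_le_one.2 hq)
    rw [ENNReal.toReal_one] at this
    linarith
  have hκ := H.tailNorm_lt_top
  refine ⟨((1 + tailNorm D ψ p * ω) ^ r * 2 ^ r *
    ((r + 1 : ℕ) : ℝ≥0∞) ^ (1 - (q⁻¹).toReal)).toNNReal, fun d hd => ?_⟩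
  have hfin : (1 + tailNorm D ψ p * ω) ^ r * 2 ^ r *
      ((r + 1 : ℕ) : ℝ≥0∞) ^ (1 - (q⁻¹).toReal) ≠ ∞ := by
    have : tailNorm D ψ p ≠ ∞ := hκ.ne
    finiteness
  rw [ENNReal.coe_toNNReal hfin, ENNReal.rpow_mul, ENNReal.rpow_natCast, mul_assoc _ (_ ^ _),
    ← ENNReal.mul_rpow_of_nonneg _ _ hs]
  refine (H.embeddingNorm_finiteOrderWeights_le hq hω .anova).trans ?_
  gcongr
  exact_mod_cast card_finiteOrderWeights_pos_le hω hd

theorem iotaNorm_lt_top (H : IsAdmissible D ψ p) (hq : 1 ≤ q) (hω : 0 < ω) (d : ℕ) :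
    iotaNorm D ψ p q (finiteOrderWeights r ω) d < ∞ := by
  have hs : 0 ≤ 1 - (q⁻¹).toReal := by
    have := ENNReal.toReal_mono ENNReal.one_ne_top (ENNReal.inv_le_one.2 hq)
    rw [ENNReal.toReal_one] at this
    linarith
  refine (H.embeddingNorm_finiteOrderWeights_le hq hω .anova).trans_lt ?_
  have : tailNorm D ψ p ≠ ∞ := H.tailNorm_lt_top.ne
  finiteness

theorem iotaNorm_isTheta (H : IsAdmissible D ψ p) (hq : 1 ≤ q) (hω : 0 < ω) :
    (fun d : ℕ => (iotaNorm D ψ p q (finiteOrderWeights r ω) d).toReal) =Θ[atTop]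
      fun d : ℕ => (d : ℝ) ^ ((r : ℝ) * (1 - (q⁻¹).toReal)) := by
  have hs : 0 ≤ 1 - (q⁻¹).toReal := by
    have := ENNReal.toReal_mono ENNReal.one_ne_top (ENNReal.inv_le_one.2 hq)
    rw [ENNReal.toReal_one] at this
    linarith
  constructor
  · obtain ⟨B, hB⟩ := H.exists_iotaNorm_le hq r hω
    refine Asymptotics.IsBigO.of_bound B ((eventually_ge_atTop 1).mono fun d hd => ?_)
    rw [Real.norm_of_nonneg ENNReal.toReal_nonneg, Real.norm_of_nonneg (by positivity)]
    have hfin : (B : ℝ≥0∞) * (d : ℝ≥0∞) ^ ((r : ℝ) * (1 - (q⁻¹).toReal)) ≠ ∞ := by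
      have : 0 ≤ (r : ℝ) * (1 - (q⁻¹).toReal) := by positivity
      finiteness
    have := ENNReal.toReal_mono hfin (hB d hd)
    simpa [ENNReal.toReal_mul, ← ENNReal.toReal_rpow] using this
  · have hpos := H.kernelCondition.integral_tail_pos H.interval H.density H.one_le
    set ℓ := ∫ t, tail D ψ t / ψ t ∂(densityMeasure D ψ)
    have hωℓ : 0 < ((ω : ℝ) * ℓ) ^ r := by positivity
    -- For fixed `r`, `C(d,r)` is of exact order `d^r`.
    have h1 : (fun d : ℕ => (d : ℝ) ^ ((r : ℝ) * (1 - (q⁻¹).toReal))) =O[atTop]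
        fun d : ℕ => (d.choose r : ℝ) ^ (1 - (q⁻¹).toReal) := by
      have := (isTheta_choose r).2.rpow hs (.of_forall fun d => by positivity)
      simpa [Real.rpow_mul, Real.rpow_natCast] using this
    refine h1.trans (Asymptotics.IsBigO.of_bound (((ω : ℝ) * ℓ) ^ r)⁻¹
      ((eventually_ge_atTop r).mono fun d hd => ?_))
    rw [Real.norm_of_nonneg ENNReal.toReal_nonneg, Real.norm_of_nonneg (by positivity),
      le_inv_mul_iff₀ hωℓ]
    exact (ENNReal.ofReal_le_iff_le_toReal (H.iotaNorm_lt_top hq hω d).ne).1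
      (H.le_iotaNorm hq hω hd)

end IsAdmissible

end Asymptotics

end AnchoredAnova

theorem mainTheorem7
    (D : Set ℝ) (hD : AnchoredAnova.IsBaseInterval D)
    (ψ : ℝ → ℝ) (hψ : AnchoredAnova.IsDensity D ψ)
    (p q : ℝ≥0∞) (hp : 1 ≤ p) (hq : 1 ≤ q)
    (hpψ : AnchoredAnova.KernelCondition D ψ p)
    (r : ℕ) (hr : 1 ≤ r) (ω : ℝ≥0) (hω : 0 < ω) :
    -- the anchored and ANOVA spaces coincide, and both embeddings have the same finite norm
    (∀ d : ℕ, 1 ≤ d →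
      AnchoredAnova.space D ψ p .anova (AnchoredAnova.finiteOrderWeights r ω d) =
        AnchoredAnova.space D ψ p .anchored (AnchoredAnova.finiteOrderWeights r ω d) ∧
      AnchoredAnova.iotaNorm D ψ p q (AnchoredAnova.finiteOrderWeights r ω) d < ∞ ∧
      AnchoredAnova.embeddingNorm D ψ p q .anchored .anova
          (AnchoredAnova.finiteOrderWeights r ω d) =
        AnchoredAnova.iotaNorm D ψ p q (AnchoredAnova.finiteOrderWeights r ω) d) ∧
    -- the embedding norm is of exact order `d^{r(1-1/q)}`
    (fun d : ℕ =>
      (AnchoredAnova.iotaNorm D ψ p q (AnchoredAnova.finiteOrderWeights r ω) d).toReal)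
        =Θ[atTop] (fun d : ℕ => (d : ℝ) ^ ((r : ℝ) * (1 - (q⁻¹).toReal))) ∧
    -- polynomial equivalence, with exponent `r(1-1/q)`
    AnchoredAnova.PolynomiallyEquivalent
      (AnchoredAnova.iotaNorm D ψ p q (AnchoredAnova.finiteOrderWeights r ω)) ∧
    AnchoredAnova.IsPolynomialExponent
      (AnchoredAnova.iotaNorm D ψ p q (AnchoredAnova.finiteOrderWeights r ω))
      ((r : ℝ) * (1 - (q⁻¹).toReal)) ∧
    -- uniform equivalence for `q = 1`
    (q = 1 → AnchoredAnova.UniformlyEquivalent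
      (AnchoredAnova.iotaNorm D ψ p q (AnchoredAnova.finiteOrderWeights r ω))) := by
  have H : AnchoredAnova.IsAdmissible D ψ p := ⟨hD, hψ, hp, hpψ⟩
  have hγ := fun d => AnchoredAnova.finiteOrderWeights_eq_zero_of_subset (d := d) (r := r) hω
  have hs : 0 ≤ 1 - (q⁻¹).toReal := by
    have := ENNReal.toReal_mono ENNReal.one_ne_top (ENNReal.inv_le_one.2 hq)
    rw [ENNReal.toReal_one] at this
    linarith
  have he : 0 ≤ (r : ℝ) * (1 - (q⁻¹).toReal) := by positivity
  have hfin := fun (d : ℕ) (_ : 1 ≤ d) => H.iotaNorm_lt_top (r := r) hq hω d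
  have hΘ := H.iotaNorm_isTheta (r := r) hq hω
  refine ⟨fun d hd => ⟨?_, hfin d hd, ?_⟩, hΘ,
    AnchoredAnova.polynomiallyEquivalent_of_isTheta he hfin hΘ,
    AnchoredAnova.isPolynomialExponent_of_isTheta he hfin hΘ, fun hq1 => ?_⟩
  · exact (H.space_subset_swap (hγ d) .anova).antisymm (H.space_subset_swap (hγ d) .anchored)
  · exact H.embeddingNorm_swap (hγ d) .anchored
  · obtain ⟨B, hB⟩ := H.exists_iotaNorm_le hq r hω
    refine lt_of_le_of_lt (iSup₂_le fun d hd => ?_) (ENNReal.coe_lt_top (r := B))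
    -- For `q = 1` the exponent `r(1 - 1/q)` is zero and the bound is just `B`.
    simpa [hq1] using hB d hd
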